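/- Let $A\in\mathbb C(z)$ be a rational function of degree $n\ge 2$, regarded as a self-map of $\mathbb{CP}^1$, which is not conjugate by a Möbius transformation to $z^{n}$ or to $z^{-n}$. Write $A^{\circ k}$ for the $k$-th iterate of $A$. For a rational function $B$, let $\Sigma(B)$ be the group of Möbius transformations $\sigma$ with $B\circ\sigma=B$, and let $\mathrm{Aut}(B)$ be the group of Möbius transformations $\sigma$ with $B\circ\sigma=\sigma\circ B$. Put $$\Sigma_\infty(A)=\bigcup_{k\ge 1}\Sigma(A^{\circ k}),\qquad \mathrm{Aut}_\infty(A)=\bigcup_{k\ge 1}\mathrm{Aut}(A^{\circ k}).$$ For a fixed point $z_0$ of $B$ and a point $z_1\ne z_0$ of $\mathbb{CP}^1$, let $G(B,z_0,z_1)$ be the group of Möbius transformations $\sigma$ such that $\sigma(z_0)=z_0$, $\sigma(z_1)=z_1$ and $B\circ\sigma=\sigma^{\circ m}\circ B$ for some $m\ge 1$. Let $k\ge 1$, and let $\sigma$ be a Möbius transformation of finite order $l>5$ with fixed points $z_0\neq z_1$, such that $A^{\circ k}(z_0)=z_0$. 1. If $\sigma\in\mathrm{Aut}(A^{\circ k})$,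 then the groups $\mathrm{Aut}_\infty(A)$ and $G(A^{\circ k},z_0,z_1)$ are finite and $|\mathrm{Aut}_\infty(A)|\le 2\,|G(A^{\circ k},z_0,z_1)|$. 2. If $\sigma\in\Sigma(A^{\circ k})$, then the groups $\Sigma_\infty(A)$ and $G(A^{\circ k},z_0,z_1)$ are finite and $|\Sigma_\infty(A)|\le 2\,|G(A^{\circ k},z_0,z_1)|$. -/

import Mathlib

open scoped OnePoint

noncomputable section

namespace RationalDynamics

/-- The Riemann sphere, i.e. the complex projective line. -/
abbrev Sphere : Type := OnePoint ℂ

/-- The self-map of the sphere induced by a rational function `A = P / Q` in lowest terms: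
a finite point `z` goes to `P z / Q z` (to `∞` if `Q z = 0`), and `∞` goes to the limit of
`P z / Q z` as `z → ∞`. -/
def toMap (A : RatFunc ℂ) : Sphere → Sphere
  | none =>
      if A.denom.natDegree < A.num.natDegree then ∞
      else ((A.num.coeff A.denom.natDegree / A.denom.leadingCoeff : ℂ) : Sphere)
  | some z =>
      if A.denom.eval z = 0 then ∞
      else ((A.num.eval z / A.denom.eval z : ℂ) : Sphere)

/-- The degree of a rational function `A = P / Q` in lowest terms, `max (deg P) (deg Q)`. -/
def degree (A : RatFunc ℂ) : ℕ := max A.num.natDegree A.denom.natDegree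

/-- The group of Möbius transformations `z ↦ (a z + b) / (c z + d)`, `a d - b c ≠ 0`, as a group of
permutations of the sphere. -/
def Moebius : Subgroup (Equiv.Perm Sphere) :=
  (MulAction.toPermHom (GL (Fin 2) ℂ) Sphere).range

/-- `A`, of degree `n`, is conjugate to `z ^ n` or to `z ^ (-n)` by a Möbius transformation. -/
def IsConjugateToPower (A : RatFunc ℂ) : Prop :=
  ∃ β : Moebius,
    (∀ z : Sphere, β • toMap A z = toMap (RatFunc.X ^ degree A) (β • z)) ∨
    (∀ z : Sphere, β • toMap A z = toMap ((RatFunc.X ^ degree A)⁻¹) (β • z))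

/-- `G(f)`: the Möbius transformations `σ` with `f ∘ σ = ν ∘ f` for some Möbius `ν`. -/
def symG (f : Sphere → Sphere) : Subgroup Moebius where
  carrier := {σ | ∃ ν : Moebius, ∀ z, f (σ • z) = ν • f z}
  one_mem' := ⟨1, fun z => by simp⟩
  mul_mem' := by
    rintro a b ⟨ν, hν⟩ ⟨μ, hμ⟩
    exact ⟨ν * μ, fun z => by rw [mul_smul, mul_smul, hν, hμ]⟩
  inv_mem' := by
    rintro a ⟨ν, hν⟩
    exact ⟨ν⁻¹, fun z => by rw [eq_inv_smul_iff, ← hν, smul_inv_smul]⟩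

/-- `Σ(f)`: the Möbius transformations `σ` with `f ∘ σ = f`. -/
def symSigma (f : Sphere → Sphere) : Subgroup Moebius where
  carrier := {σ | ∀ z, f (σ • z) = f z}
  one_mem' := fun z => by simp
  mul_mem' := by
    intro a b ha hb z
    rw [mul_smul, ha, hb]
  inv_mem' := by
    intro a ha z
    rw [← ha, smul_inv_smul]

/-- `Aut(f)`: the Möbius transformations `σ` with `f ∘ σ = σ ∘ f`. -/
def symAut (f : Sphere → Sphere) : Subgroup Moebius where
  carrier := {σ | ∀ z, f (σ • z) = σ • f z}
  one_mem' := fun z => by simp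
  mul_mem' := by
    intro a b ha hb z
    rw [mul_smul, mul_smul, ha, hb]
  inv_mem' := by
    intro a ha z
    rw [eq_inv_smul_iff, ← ha, smul_inv_smul]

/-- `Σ_∞(f)`, the union of the groups `Σ(f^{∘k})` over `k ≥ 1`. -/
def sigmaInf (f : Sphere → Sphere) : Set Moebius :=
  ⋃ k : ℕ, ⋃ _ : 1 ≤ k, (symSigma f^[k] : Set Moebius)

/-- `Aut_∞(f)`, the union of the groups `Aut(f^{∘k})` over `k ≥ 1`. -/
def autInf (f : Sphere → Sphere) : Set Moebius :=
  ⋃ k : ℕ, ⋃ _ : 1 ≤ k, (symAut f^[k] : Set Moebius)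

/-- `G(f, z₀, z₁)`: the elements `σ` of `G(f)` which fix `z₀` and `z₁` and for which
the Möbius transformation `ν` with `f ∘ σ = ν ∘ f` is a power `σ^{∘m}`, `m ≥ 1`.
It is used only for `f z₀ = z₀` and `z₁ ≠ z₀`. -/
def localG (f : Sphere → Sphere) (z₀ z₁ : Sphere) : Set Moebius :=
  {σ | σ ∈ symG f ∧ σ • z₀ = z₀ ∧ σ • z₁ = z₁ ∧
    ∃ m : ℕ, 1 ≤ m ∧ ∀ z, f (σ • z) = (σ ^ m) • f z}

end RationalDynamics

end

open scoped OnePoint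

noncomputable section

namespace RationalDynamics

/-! Put `f = A^{∘k}`. Every `τ` in `Aut_∞(A)` or `Σ_∞(A)` lies, together with `σ`, in the
corresponding group of one iterate `f^{∘j}`. That group is finite: elements of `Σ` preserve fibres,
elements of `Aut` preserve the finite set of points whose second image is fixed, and a Möbius
transformation is determined by its values at three points. Three suitable points can be missing for
`Aut` only if `z₀` and some other point are totally invariant, and then `A` would be conjugate to `z
^ n` or `z ^ (-n)`.

In a finite Möbius group, Burnside's count on the points with nontrivial stabilizer shows that a
point with stabilizer of order at least `6` has an orbit of length at most `2`; the threshold comes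
from `1/2 + 1/3 + 1/6 = 1`. Hence `τ z₀` is `z₀` or `z₁` (`smul_eq_or_eq_of_mem`), and up to a
factor of two only the `τ` fixing both points have to be counted.

Move `z₀` to `0` and `z₁` to `∞`. Such a `τ` is `z ↦ ε z`, and an iterate of the germ `b` of `f` at
`0` is equivariant under it. By `scaling_of_iterate_scaling` the germ `b` itself is equivariant, so
that `τ` belongs to `G(f, z₀, z₁)`. The proof compares leading terms in the relation `b ∘ b^r = b^r
∘ b` at `ε z`: for a superattracting point the orders disagree, and for a nonzero multiplier the
question reduces to an iterate tangent to the identity, where second terms are compared. Finally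
`G(f, z₀, z₁)` is finite (`IsRational.finite_localG`): since `b` is not a monomial, its two lowest
terms make `ε` a root of unity of bounded order. -/

/-! ### Homogeneous coordinates and Möbius transformations -/

/-- The point of the sphere with homogeneous coordinates `[x : y]`. -/
def pt (x y : ℂ) : Sphere := if y = 0 then ∞ else ((x / y : ℂ) : Sphere)

lemma pt_one (z : ℂ) : pt z 1 = (z : Sphere) := by simp [pt]

lemma pt_zero_right (x : ℂ) : pt x 0 = ∞ := by simp [pt]

lemma pt_zero_left {y : ℂ} (hy : y ≠ 0) : pt 0 y = ((0 : ℂ) : Sphere) := by simp [pt, hy]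

lemma exists_eq_pt (z : Sphere) : ∃ x y : ℂ, (x ≠ 0 ∨ y ≠ 0) ∧ z = pt x y := by
  induction z using OnePoint.rec with
  | infty => exact ⟨1, 0, by simp, by simp [pt]⟩
  | coe z => exact ⟨z, 1, by simp, by simp [pt]⟩

lemma pt_eq_pt_iff {x y x' y' : ℂ} (h : x ≠ 0 ∨ y ≠ 0) (h' : x' ≠ 0 ∨ y' ≠ 0) :
    pt x y = pt x' y' ↔ x * y' = x' * y := by
  unfold pt
  by_cases hy : y = 0 <;> by_cases hy' : y' = 0
  · simp [hy, hy']
  · have : x ≠ 0 := by simpa [hy] using h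
    simp [hy, hy', this]
  · have : x' ≠ 0 := by simpa [hy'] using h'
    simp [hy, hy', this]
  · rw [if_neg hy, if_neg hy', OnePoint.coe_eq_coe, div_eq_div_iff hy hy']

lemma pt_eq_infty_iff {x y : ℂ} : pt x y = ∞ ↔ y = 0 := by
  unfold pt
  split_ifs with h <;> simp [h]

lemma pt_eq_zero_iff {x y : ℂ} (h : x ≠ 0 ∨ y ≠ 0) : pt x y = ((0 : ℂ) : Sphere) ↔ x = 0 := by
  rw [← pt_one 0, pt_eq_pt_iff h (by simp)]
  simp

lemma pt_mul_mul {t : ℂ} (ht : t ≠ 0) (x y : ℂ) : pt (t * x) (t * y) = pt x y := by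
  unfold pt
  by_cases hy : y = 0
  · simp [hy]
  · simp [hy, ht, mul_div_mul_left]

lemma moebius_coord_ne_zero {a b c d x y : ℂ} (hdet : a * d - b * c ≠ 0) (h : x ≠ 0 ∨ y ≠ 0) :
    a * x + b * y ≠ 0 ∨ c * x + d * y ≠ 0 := by
  by_contra! hc
  obtain ⟨h1, h2⟩ := hc
  have hx : (a * d - b * c) * x = 0 := by linear_combination d * h1 - b * h2
  have hy : (a * d - b * c) * y = 0 := by linear_combination a * h2 - c * h1
  rcases h with h | h
  · exact (mul_ne_zero hdet h) hx
  · exact (mul_ne_zero hdet h) hy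

lemma gl_smul_pt (M : GL (Fin 2) ℂ) {x y : ℂ} (h : x ≠ 0 ∨ y ≠ 0) :
    M • pt x y = pt (M 0 0 * x + M 0 1 * y) (M 1 0 * x + M 1 1 * y) := by
  by_cases hy : y = 0
  · have hx : x ≠ 0 := by simpa [hy] using h
    subst hy
    rw [pt_zero_right, OnePoint.smul_infty_eq_ite]
    unfold pt
    by_cases hc : M 1 0 = 0
    · simp [hc]
    · simp only [hc, if_false, mul_zero, add_zero, mul_eq_zero, hx, or_self]
      rw [mul_div_mul_right _ _ hx]
  · have : pt x y = ((x / y : ℂ) : Sphere) := by simp [pt, hy]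
    rw [this, OnePoint.smul_some_eq_ite]
    have e1 : M 1 0 * x + M 1 1 * y = (M 1 0 * (x / y) + M 1 1) * y := by field_simp
    have e2 : M 0 0 * x + M 0 1 * y = (M 0 0 * (x / y) + M 0 1) * y := by field_simp
    unfold pt
    rw [e1, e2]
    by_cases hc : M 1 0 * (x / y) + M 1 1 = 0
    · simp [hc]
    · rw [if_neg hc, if_neg (mul_ne_zero hc hy), mul_div_mul_right _ _ hy]

lemma moebius_smul_pt (g : Moebius) : ∃ a b c d : ℂ, a * d - b * c ≠ 0 ∧
    ∀ x y : ℂ, (x ≠ 0 ∨ y ≠ 0) → g • pt x y = pt (a * x + b * y) (c * x + d * y) := by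
  obtain ⟨g, M, rfl⟩ := g
  refine ⟨M 0 0, M 0 1, M 1 0, M 1 1, ?_, fun x y h => gl_smul_pt M h⟩
  have := M.det_ne_zero
  rwa [Matrix.det_fin_two] at this

lemma exists_moebius {a b c d : ℂ} (hdet : a * d - b * c ≠ 0) : ∃ g : Moebius,
    ∀ x y : ℂ, (x ≠ 0 ∨ y ≠ 0) → g • pt x y = pt (a * x + b * y) (c * x + d * y) := by
  let M : GL (Fin 2) ℂ := Matrix.GeneralLinearGroup.mkOfDetNeZero !![a, b; c, d]
    (by rwa [Matrix.det_fin_two_of])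
  exact ⟨⟨_, M, rfl⟩, fun x y h => gl_smul_pt M h⟩

lemma exists_moebius_zero_infty {z₀ z₁ : Sphere} (h : z₀ ≠ z₁) :
    ∃ β : Moebius, β • z₀ = ((0 : ℂ) : Sphere) ∧ β • z₁ = ∞ := by
  obtain ⟨x₀, y₀, h₀, rfl⟩ := exists_eq_pt z₀
  obtain ⟨x₁, y₁, h₁, rfl⟩ := exists_eq_pt z₁
  rw [Ne, pt_eq_pt_iff h₀ h₁] at h
  have hdet : y₀ * (-x₁) - (-x₀) * y₁ ≠ 0 := fun h' => h (by linear_combination h')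
  obtain ⟨β, hβ⟩ := exists_moebius hdet
  refine ⟨β, ?_, ?_⟩
  · rw [hβ _ _ h₀, pt_eq_zero_iff (moebius_coord_ne_zero hdet h₀)]
    ring
  · rw [hβ _ _ h₁, pt_eq_infty_iff]
    ring

lemma moebius_diagonal {g : Moebius} (h0 : g • ((0 : ℂ) : Sphere) = ((0 : ℂ) : Sphere))
    (h1 : g • (∞ : Sphere) = ∞) :
    ∃ ε : ℂ, ε ≠ 0 ∧ ∀ x y : ℂ, (x ≠ 0 ∨ y ≠ 0) → g • pt x y = pt (ε * x) y := by
  obtain ⟨a, b, c, d, hdet, hg⟩ := moebius_smul_pt g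
  have hb : b = 0 := by
    rw [← pt_one 0, hg _ _ (by simp), pt_one, pt_eq_zero_iff (by
      simpa using moebius_coord_ne_zero (x := 0) (y := 1) hdet (by simp))] at h0
    simpa using h0
  have hc : c = 0 := by
    rw [← pt_zero_right 1, hg _ _ (by simp), pt_zero_right, pt_eq_infty_iff] at h1
    simpa using h1
  subst hb hc
  have ha : a ≠ 0 := fun h => hdet (by simp [h])
  have hd : d ≠ 0 := fun h => hdet (by simp [h])
  refine ⟨a / d, div_ne_zero ha hd, fun x y h => ?_⟩
  rw [hg _ _ h, ← pt_mul_mul hd (a / d * x) y]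
  congr 1 <;> field_simp <;> ring

lemma moebius_ext {g h : Moebius} (H : ∀ z : Sphere, g • z = h • z) : g = h :=
  Subtype.ext (Equiv.ext H)

lemma moebius_eq_one_of_fixes_three {g : Moebius} {p q r : Sphere} (hpq : p ≠ q) (hpr : p ≠ r)
    (hqr : q ≠ r) (hp : g • p = p) (hq : g • q = q) (hr : g • r = r) : g = 1 := by
  obtain ⟨β, h0, h1⟩ := exists_moebius_zero_infty hpq
  have hβp : p = β⁻¹ • ((0 : ℂ) : Sphere) := by rw [← h0, inv_smul_smul]
  have hβq : q = β⁻¹ • (∞ : Sphere) := by rw [← h1, inv_smul_smul]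
  obtain ⟨ε, hε, hg⟩ := moebius_diagonal (g := β * g * β⁻¹)
    (by rw [mul_smul, mul_smul, ← hβp, hp, h0]) (by rw [mul_smul, mul_smul, ← hβq, hq, h1])
  obtain ⟨x, y, hxy, hβr⟩ := exists_eq_pt (β • r)
  have hr' := hg x y hxy
  rw [← hβr, mul_smul, inv_smul_smul, mul_smul, hr, hβr, pt_eq_pt_iff hxy (by simpa [hε])] at hr'
  have hy : y ≠ 0 := fun hy => hqr (by
    rw [hβq, eq_comm, ← pt_zero_right x, eq_inv_smul_iff, hβr, hy])
  have hx : x ≠ 0 := fun hx => hpr (by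
    rw [hβp, eq_comm, eq_inv_smul_iff, hβr, hx, pt_zero_left hy])
  have hε1 : ε = 1 := by
    have : (ε - 1) * (x * y) = 0 := by linear_combination -hr'
    rcases mul_eq_zero.1 this with h | h
    · linear_combination h
    · exact absurd h (mul_ne_zero hx hy)
  have : β * g * β⁻¹ = 1 := moebius_ext fun z => by
    obtain ⟨x, y, hxy, rfl⟩ := exists_eq_pt z
    rw [hg x y hxy, hε1, one_mul, one_smul]
  simpa [mul_inv_eq_one] using this

lemma moebius_exists_fixed (g : Moebius) : ∃ z : Sphere, g • z = z := by
  obtain ⟨a, b, c, d, hdet, hg⟩ := moebius_smul_pt g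
  by_cases hc : c = 0
  · refine ⟨∞, ?_⟩
    rw [← pt_zero_right 1, hg _ _ (by simp), pt_zero_right, pt_eq_infty_iff]
    simp [hc]
  · obtain ⟨s, hs⟩ := IsAlgClosed.exists_pow_nat_eq (discrim c (d - a) (-b)) (n := 2) (by norm_num)
    obtain ⟨x, hx⟩ := exists_quadratic_eq_zero hc ⟨s, by rw [← hs]; ring⟩
    refine ⟨pt x 1, ?_⟩
    rw [hg _ _ (by simp), pt_eq_pt_iff (moebius_coord_ne_zero hdet (by simp)) (by simp)]
    linear_combination -hx

/-- With the fixed point moved to `∞` the map is affine. Only a nontrivial translation has no finite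
fixed point, and a translation has infinite order; `0 < orderOf g` says that the order is finite. -/
lemma moebius_exists_second_fixed {g : Moebius} (hg : 0 < orderOf g) {p : Sphere}
    (hp : g • p = p) : ∃ q : Sphere, q ≠ p ∧ g • q = q := by
  obtain ⟨r, hr⟩ : ∃ r : Sphere, r ≠ p := exists_ne p
  obtain ⟨β, h0, h1⟩ := exists_moebius_zero_infty hr
  have hβp : p = β⁻¹ • (∞ : Sphere) := by rw [← h1, inv_smul_smul]
  obtain ⟨a, b, c, d, hdet, hh⟩ := moebius_smul_pt (β * g * β⁻¹)
  have hc : c = 0 := by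
    have : (β * g * β⁻¹) • (∞ : Sphere) = ∞ := by
      rw [mul_smul, mul_smul, ← hβp, hp, h1]
    rw [← pt_zero_right 1, hh _ _ (by simp), pt_zero_right, pt_eq_infty_iff] at this
    simpa using this
  subst hc
  have ha : a ≠ 0 := fun h => hdet (by simp [h])
  have hd : d ≠ 0 := fun h => hdet (by simp [h])
  suffices ∃ x : ℂ, (a - d) * x + b = 0 by
    obtain ⟨x, hx⟩ := this
    refine ⟨β⁻¹ • pt x 1, fun h => ?_, ?_⟩
    · rw [hβp] at h
      have := (smul_left_cancel_iff _).1 h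
      rw [pt_eq_infty_iff] at this
      simp at this
    · have : (β * g * β⁻¹) • pt x 1 = pt x 1 := by
        rw [hh _ _ (by simp), pt_eq_pt_iff (by right; simpa) (by simp)]
        linear_combination hx
      rw [mul_smul, mul_smul] at this
      rw [eq_inv_smul_iff, this]
  by_cases hab : a = d
  · have hit : ∀ n : ℕ, (β * g * β⁻¹) ^ n • pt 0 1 = pt (n * (b / d)) 1 := by
      intro n
      induction n with
      | zero => simp
      | succ n ih =>
        rw [pow_succ', mul_smul, ih, hh _ _ (by simp), pt_eq_pt_iff (by right; simpa) (by simp)]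
        push_cast
        field_simp
        rw [hab]
        ring
    have h := hit (orderOf g)
    rw [conj_pow, pow_orderOf_eq_one, mul_one, mul_inv_cancel, one_smul,
      pt_eq_pt_iff (by simp) (by simp)] at h
    have hb : b = 0 := by
      have hn : (orderOf g : ℂ) ≠ 0 := by exact_mod_cast hg.ne'
      field_simp at h
      simpa [hn] using h.symm
    exact ⟨0, by simp [hb]⟩
  · refine ⟨-b / (a - d), ?_⟩
    have := sub_ne_zero.2 hab
    field_simp
    ring

lemma moebius_fixedPoints {g : Moebius} (hg : 0 < orderOf g) (hg1 : g ≠ 1) :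
    ∃ p q : Sphere, p ≠ q ∧ ∀ z, g • z = z ↔ z = p ∨ z = q := by
  obtain ⟨p, hp⟩ := moebius_exists_fixed g
  obtain ⟨q, hqp, hq⟩ := moebius_exists_second_fixed hg hp
  refine ⟨p, q, hqp.symm, fun z => ⟨fun hz => ?_, ?_⟩⟩
  · by_contra! h
    exact hg1 (moebius_eq_one_of_fixes_three hqp.symm h.1.symm h.2.symm hp hq hz)
  · rintro (rfl | rfl) <;> assumption

/-! ### Binary forms and rational maps -/

open Polynomial

/-- The value at `(x, y)` of the homogeneous form of degree `N` obtained from `P`. -/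
def form (N : ℕ) (P : ℂ[X]) (x y : ℂ) : ℂ :=
  ∑ i ∈ Finset.range (N + 1), P.coeff i * x ^ i * y ^ (N - i)

lemma form_one {N : ℕ} {P : ℂ[X]} (hP : P.natDegree ≤ N) (z : ℂ) : form N P z 1 = P.eval z := by
  rw [form, Polynomial.eval_eq_sum_range' (Nat.lt_succ_of_le hP)]
  simp

lemma form_smul (N : ℕ) (P : ℂ[X]) (t x y : ℂ) :
    form N P (t * x) (t * y) = t ^ N * form N P x y := by
  rw [form, form, Finset.mul_sum]
  refine Finset.sum_congr rfl fun i hi => ?_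
  have : t ^ N = t ^ i * t ^ (N - i) := by
    rw [← pow_add]; congr 1; have := Finset.mem_range.1 hi; omega
  rw [this]
  ring

lemma form_zero_right (N : ℕ) (P : ℂ[X]) (x : ℂ) : form N P x 0 = P.coeff N * x ^ N := by
  rw [form, Finset.sum_range_succ, Finset.sum_eq_zero]
  · simp
  · intro i hi
    have := Finset.mem_range.1 hi
    rw [zero_pow (by omega), mul_zero]

lemma form_of_ne_zero {N : ℕ} {P : ℂ[X]} (hP : P.natDegree ≤ N) (x : ℂ) {y : ℂ} (hy : y ≠ 0) :
    form N P x y = y ^ N * P.eval (x / y) := by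
  rw [← form_one hP, ← form_smul]
  congr 1 <;> field_simp

lemma form_mul {N M : ℕ} {P Q : ℂ[X]} (hP : P.natDegree ≤ N) (hQ : Q.natDegree ≤ M) (x y : ℂ) :
    form (N + M) (P * Q) x y = form N P x y * form M Q x y := by
  by_cases hy : y = 0
  · subst hy
    simp only [form_zero_right, Polynomial.coeff_mul_add_eq_of_natDegree_le hP hQ]
    ring
  · rw [form_of_ne_zero hP _ hy, form_of_ne_zero hQ _ hy,
      form_of_ne_zero (natDegree_mul_le_of_le hP hQ) _ hy, eval_mul]
    ring

lemma form_add (N : ℕ) (P Q : ℂ[X]) (x y : ℂ) :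
    form N (P + Q) x y = form N P x y + form N Q x y := by
  simp [form, add_mul, Finset.sum_add_distrib]

lemma form_sub (N : ℕ) (P Q : ℂ[X]) (x y : ℂ) :
    form N (P - Q) x y = form N P x y - form N Q x y := by
  simp [form, sub_mul, Finset.sum_sub_distrib]

lemma form_C_mul (N : ℕ) (a : ℂ) (P : ℂ[X]) (x y : ℂ) :
    form N (C a * P) x y = a * form N P x y := by
  simp [form, Finset.mul_sum, mul_assoc]

lemma form_X (x y : ℂ) : form 1 X x y = x := by
  simp [form, Polynomial.coeff_X]

lemma form_one_one (x y : ℂ) : form 1 1 x y = y := by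
  simp [form, Polynomial.coeff_one]

/-- A drop of the degree of `P` below `N` is a zero of the form at `∞`; without a drop there is a
finite root. -/
lemma exists_form_eq_zero {N : ℕ} (hN : 1 ≤ N) {P : ℂ[X]} (hP : P.natDegree ≤ N) :
    ∃ x y : ℂ, (x ≠ 0 ∨ y ≠ 0) ∧ form N P x y = 0 := by
  by_cases h : P.coeff N = 0
  · exact ⟨1, 0, by simp, by simp [form_zero_right, h]⟩
  · have hd : P.natDegree = N := le_antisymm hP (le_natDegree_of_ne_zero h)
    obtain ⟨z, hz⟩ := IsAlgClosed.exists_root P (by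
      intro h0
      have : P.natDegree = 0 := natDegree_eq_of_degree_eq_some h0
      omega)
    exact ⟨z, 1, by simp, by rw [form_one hP]; exact hz⟩

lemma finite_form_eq_zero {N : ℕ} {P : ℂ[X]} (hP : P.natDegree ≤ N) (h0 : P ≠ 0) :
    {p : Sphere | ∃ x y : ℂ, (x ≠ 0 ∨ y ≠ 0) ∧ p = pt x y ∧ form N P x y = 0}.Finite := by
  refine ((Set.finite_singleton (∞ : Sphere)).union
    ((P.roots.toFinset.finite_toSet).image (fun z : ℂ => (z : Sphere)))).subset ?_
  rintro _ ⟨x, y, h, rfl, hf⟩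
  by_cases hy : y = 0
  · left; simp [hy, pt_zero_right]
  · right
    refine ⟨x / y, ?_, by simp [pt, hy]⟩
    rw [form_of_ne_zero hP _ hy] at hf
    simpa [h0, hy] using hf

/-- `f` is the map `[x : y] ↦ [P(x, y) : Q(x, y)]` given by two forms of degree `N` without common
zero. -/
structure Represents (f : Sphere → Sphere) (N : ℕ) (P Q : ℂ[X]) : Prop where
  natDegree_left : P.natDegree ≤ N
  natDegree_right : Q.natDegree ≤ N
  ne_zero : ∀ x y : ℂ, (x ≠ 0 ∨ y ≠ 0) → form N P x y ≠ 0 ∨ form N Q x y ≠ 0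
  map_pt : ∀ x y : ℂ, (x ≠ 0 ∨ y ≠ 0) → f (pt x y) = pt (form N P x y) (form N Q x y)

/-- `f` is a rational self-map of degree `N` of the sphere. -/
def IsRational (f : Sphere → Sphere) (N : ℕ) : Prop := ∃ P Q : ℂ[X], Represents f N P Q

lemma toMap_pt {A : RatFunc ℂ} {x y : ℂ} (h : x ≠ 0 ∨ y ≠ 0) :
    toMap A (pt x y) = pt (form (degree A) A.num x y) (form (degree A) A.denom x y) := by
  have hP : A.num.natDegree ≤ degree A := le_max_left _ _
  have hQ : A.denom.natDegree ≤ degree A := le_max_right _ _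
  by_cases hy : y = 0
  · have hx : x ≠ 0 := by simpa [hy] using h
    subst hy
    simp only [form_zero_right, pt_zero_right]
    change (if A.denom.natDegree < A.num.natDegree then (∞ : Sphere)
      else ((A.num.coeff A.denom.natDegree / A.denom.leadingCoeff : ℂ) : Sphere)) = _
    split_ifs with hlt
    · have : A.denom.coeff (degree A) = 0 :=
        Polynomial.coeff_eq_zero_of_natDegree_lt (lt_of_lt_of_le hlt hP)
      simp [this, pt_zero_right]
    · have hd : degree A = A.denom.natDegree := max_eq_right (not_lt.1 hlt)
      rw [hd]
      have h1 : A.denom.coeff A.denom.natDegree ≠ 0 := by simpa using A.denom_ne_zero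
      rw [pt, if_neg (mul_ne_zero h1 (pow_ne_zero _ hx)), mul_div_mul_right _ _ (pow_ne_zero _ hx)]
      rfl
  · have : pt x y = ((x / y : ℂ) : Sphere) := by simp [pt, hy]
    rw [this, form_of_ne_zero hP _ hy, form_of_ne_zero hQ _ hy, pt_mul_mul (pow_ne_zero _ hy)]
    rfl

lemma isRational_toMap (A : RatFunc ℂ) : IsRational (toMap A) (degree A) := by
  have hcop := A.isCoprime_num_denom
  have hP : A.num.natDegree ≤ degree A := le_max_left _ _
  have hQ : A.denom.natDegree ≤ degree A := le_max_right _ _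
  refine ⟨A.num, A.denom, hP, hQ, fun x y h => ?_,
    fun x y h => toMap_pt h⟩
  · by_cases hy : y = 0
    · have hx : x ≠ 0 := by simpa [hy] using h
      subst hy
      simp only [form_zero_right]
      rcases max_choice A.num.natDegree A.denom.natDegree with hm | hm
      · by_cases hn : A.num = 0
        · right
          have hd : A.denom.natDegree ≤ 0 := by
            have := le_max_right A.num.natDegree A.denom.natDegree
            rw [hm, hn] at this
            simpa using this
          have h0 : degree A = A.denom.natDegree := by
            rw [degree, hm, hn]
            simp at hd
            simp [hd]
          rw [h0]
          exact mul_ne_zero (by simpa using A.denom_ne_zero) (pow_ne_zero _ hx)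
        · left
          rw [degree, hm]
          exact mul_ne_zero (by simpa using hn) (pow_ne_zero _ hx)
      · right
        rw [degree, hm]
        exact mul_ne_zero (by simpa using A.denom_ne_zero) (pow_ne_zero _ hx)
    · by_contra! hc
      rw [form_of_ne_zero hP _ hy, form_of_ne_zero hQ _ hy] at hc
      obtain ⟨u, v, huv⟩ := hcop
      have := congrArg (Polynomial.eval (x / y)) huv
      have h1 := (mul_eq_zero.1 hc.1).resolve_left (pow_ne_zero _ hy)
      have h2 := (mul_eq_zero.1 hc.2).resolve_left (pow_ne_zero _ hy)
      simp [h1, h2] at this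

lemma isRational_moebius (g : Moebius) : IsRational (fun z => g • z) 1 := by
  obtain ⟨a, b, c, d, hdet, hg⟩ := moebius_smul_pt g
  have key : ∀ a b x y : ℂ, form 1 (C a * X + C b * 1) x y = a * x + b * y := by
    intro a b x y
    rw [form_add, form_C_mul, form_C_mul, form_X, form_one_one]
  have hdeg : ∀ a b : ℂ, (C a * X + C b * 1 : ℂ[X]).natDegree ≤ 1 := by
    intro a b
    rw [mul_one]
    exact natDegree_linear_le
  refine ⟨C a * X + C b * 1, C c * X + C d * 1, hdeg _ _, hdeg _ _, fun x y h => ?_,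
    fun x y h => ?_⟩
  · rw [key, key]
    exact moebius_coord_ne_zero hdet h
  · rw [key, key]
    exact hg x y h

/-- Substitution of `R / S` in the form of degree `N` obtained from `P`. -/
def substForm (N : ℕ) (P R S : ℂ[X]) : ℂ[X] :=
  ∑ i ∈ Finset.range (N + 1), C (P.coeff i) * R ^ i * S ^ (N - i)

lemma natDegree_monomial_le {N M i : ℕ} (hi : i ≤ N) {R S : ℂ[X]} (hR : R.natDegree ≤ M)
    (hS : S.natDegree ≤ M) : (R ^ i * S ^ (N - i)).natDegree ≤ N * M := by
  have h1 := natDegree_pow_le_of_le i hR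
  have h2 := natDegree_pow_le_of_le (N - i) hS
  refine (natDegree_mul_le_of_le h1 h2).trans (le_of_eq ?_)
  rw [← add_mul]
  congr 1
  omega

lemma natDegree_substForm_le {N M : ℕ} (P : ℂ[X]) {R S : ℂ[X]} (hR : R.natDegree ≤ M)
    (hS : S.natDegree ≤ M) : (substForm N P R S).natDegree ≤ N * M := by
  refine natDegree_sum_le_of_forall_le _ _ fun i hi => ?_
  rw [mul_assoc]
  exact (natDegree_C_mul_le _ _).trans
    (natDegree_monomial_le (Nat.lt_succ_iff.1 (Finset.mem_range.1 hi)) hR hS)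

lemma form_substForm {N M : ℕ} (P : ℂ[X]) {R S : ℂ[X]} (hR : R.natDegree ≤ M)
    (hS : S.natDegree ≤ M) (x y : ℂ) :
    form (N * M) (substForm N P R S) x y = form N P (form M R x y) (form M S x y) := by
  by_cases hy : y = 0
  · subst hy
    simp only [form_zero_right]
    rw [form, substForm, finsetSum_coeff, Finset.sum_mul]
    refine Finset.sum_congr rfl fun i hi => ?_
    have hi' := Nat.lt_succ_iff.1 (Finset.mem_range.1 hi)
    have e : N * M = i * M + (N - i) * M := by rw [← add_mul]; congr 1; omega
    rw [mul_assoc, coeff_C_mul, e, coeff_mul_add_eq_of_natDegree_le (natDegree_pow_le_of_le i hR)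
      (natDegree_pow_le_of_le (N - i) hS), mul_comm i M, mul_comm (N - i) M, 
      mul_comm M i, mul_comm M (N - i), coeff_pow_of_natDegree_le hR, coeff_pow_of_natDegree_le hS,
      pow_add, mul_pow, mul_pow, pow_mul', pow_mul']
    ring
  · rw [form_of_ne_zero (natDegree_substForm_le P hR hS) _ hy, form_of_ne_zero hR _ hy,
      form_of_ne_zero hS _ hy, form_smul, ← pow_mul, mul_comm N M, form, substForm, eval_finsetSum]
    simp

/-- Pairs of forms without common zero are stable under substitution, so degrees multiply and no
fraction has to be reduced to lowest terms. -/
lemma IsRational.comp {f g : Sphere → Sphere} {N M : ℕ} (hf : IsRational f N)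
    (hg : IsRational g M) : IsRational (f ∘ g) (N * M) := by
  obtain ⟨P, Q, hf⟩ := hf
  obtain ⟨R, S, hg⟩ := hg
  refine ⟨substForm N P R S, substForm N Q R S,
    natDegree_substForm_le P hg.natDegree_left hg.natDegree_right,
    natDegree_substForm_le Q hg.natDegree_left hg.natDegree_right, fun x y h => ?_,
    fun x y h => ?_⟩
  · rw [form_substForm P hg.natDegree_left hg.natDegree_right,
      form_substForm Q hg.natDegree_left hg.natDegree_right]
    exact hf.ne_zero _ _ (hg.ne_zero _ _ h)
  · rw [form_substForm P hg.natDegree_left hg.natDegree_right,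
      form_substForm Q hg.natDegree_left hg.natDegree_right, Function.comp_apply,
      hg.map_pt _ _ h, hf.map_pt _ _ (hg.ne_zero _ _ h)]

lemma IsRational.iterate {f : Sphere → Sphere} {N : ℕ} (hf : IsRational f N) (k : ℕ) :
    IsRational f^[k] (N ^ k) := by
  induction k with
  | zero =>
    simpa [Function.id_def] using isRational_moebius 1
  | succ k ih =>
    rw [Function.iterate_succ, pow_succ]
    exact ih.comp hf

lemma IsRational.conj {f : Sphere → Sphere} {N : ℕ} (hf : IsRational f N) (β : Moebius) :
    IsRational (fun z => β • f (β⁻¹ • z)) N := by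
  have := ((isRational_moebius β).comp hf).comp (isRational_moebius β⁻¹)
  simpa [Function.comp_def] using this

/-- Two rational maps which agree on an infinite set are equal. -/
lemma IsRational.eq_of_infinite {f g : Sphere → Sphere} {N M : ℕ} (hf : IsRational f N)
    (hg : IsRational g M) (h : {z | f z = g z}.Infinite) : f = g := by
  obtain ⟨P, Q, hf⟩ := hf
  obtain ⟨R, S, hg⟩ := hg
  have hd1 := natDegree_mul_le_of_le hf.natDegree_left hg.natDegree_right
  have hd2 := natDegree_mul_le_of_le hf.natDegree_right hg.natDegree_left
  have hform : ∀ x y, form (N + M) (P * S - Q * R) x y =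
      form N P x y * form M S x y - form N Q x y * form M R x y := by
    intro x y
    rw [form_sub, form_mul hf.natDegree_left hg.natDegree_right,
      form_mul hf.natDegree_right hg.natDegree_left]
  have hiff : ∀ x y : ℂ, (x ≠ 0 ∨ y ≠ 0) →
      (f (pt x y) = g (pt x y) ↔ form (N + M) (P * S - Q * R) x y = 0) := by
    intro x y hxy
    rw [hf.map_pt _ _ hxy, hg.map_pt _ _ hxy, pt_eq_pt_iff (hf.ne_zero _ _ hxy)
      (hg.ne_zero _ _ hxy), hform, sub_eq_zero, mul_comm (form M R x y)]
  have h0 : P * S - Q * R = 0 := by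
    by_contra h0
    refine h ((finite_form_eq_zero ((natDegree_sub_le_of_le hd1 hd2).trans (max_self _).le)
      h0).subset fun z hz => ?_)
    obtain ⟨x, y, hxy, rfl⟩ := exists_eq_pt z
    exact ⟨x, y, hxy, rfl, (hiff x y hxy).1 hz⟩
  ext z
  obtain ⟨x, y, hxy, rfl⟩ := exists_eq_pt z
  rw [hiff x y hxy, h0]
  simp [form]

lemma Represents.fibre_iff {f : Sphere → Sphere} {N : ℕ} {P Q : ℂ[X]} (hf : Represents f N P Q)
    {a b : ℂ} (hab : a ≠ 0 ∨ b ≠ 0) {x y : ℂ} (hxy : x ≠ 0 ∨ y ≠ 0) :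
    f (pt x y) = pt a b ↔ form N (C b * P - C a * Q) x y = 0 := by
  rw [hf.map_pt _ _ hxy, pt_eq_pt_iff (hf.ne_zero _ _ hxy) hab, form_sub, form_C_mul, form_C_mul,
    sub_eq_zero, mul_comm]

lemma Represents.natDegree_fibre_le {f : Sphere → Sphere} {N : ℕ} {P Q : ℂ[X]}
    (hf : Represents f N P Q) (a b : ℂ) : (C b * P - C a * Q).natDegree ≤ N :=
  (natDegree_sub_le_of_le ((natDegree_C_mul_le _ _).trans hf.natDegree_left)
    ((natDegree_C_mul_le _ _).trans hf.natDegree_right)).trans (max_self _).le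

lemma IsRational.surjective {f : Sphere → Sphere} {N : ℕ} (hf : IsRational f N) (hN : 1 ≤ N) :
    Function.Surjective f := by
  obtain ⟨P, Q, hf⟩ := hf
  intro w
  obtain ⟨a, b, hab, rfl⟩ := exists_eq_pt w
  obtain ⟨x, y, hxy, h⟩ := exists_form_eq_zero hN (hf.natDegree_fibre_le a b)
  exact ⟨pt x y, (hf.fibre_iff hab hxy).2 h⟩

/-- The fibre is the zero set of one form; if that form vanished identically, `f` would be constant
and not surjective. -/
lemma IsRational.finite_fibre {f : Sphere → Sphere} {N : ℕ} (hf : IsRational f N) (hN : 1 ≤ N)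
    (w : Sphere) : (f ⁻¹' {w}).Finite := by
  have hsurj := hf.surjective hN
  obtain ⟨P, Q, hf⟩ := hf
  obtain ⟨a, b, hab, rfl⟩ := exists_eq_pt w
  by_cases h0 : C b * P - C a * Q = 0
  · exfalso
    have hall : ∀ z, f z = pt a b := by
      intro z
      obtain ⟨x, y, hxy, rfl⟩ := exists_eq_pt z
      rw [hf.fibre_iff hab hxy, h0]
      simp [form]
    obtain ⟨w, hw⟩ := exists_ne (pt a b)
    obtain ⟨z, rfl⟩ := hsurj w
    exact hw (hall z)
  · refine (finite_form_eq_zero (hf.natDegree_fibre_le a b) h0).subset fun z hz => ?_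
    obtain ⟨x, y, hxy, rfl⟩ := exists_eq_pt z
    exact ⟨x, y, hxy, rfl, (hf.fibre_iff hab hxy).1 hz⟩

lemma IsRational.finite_preimage {f : Sphere → Sphere} {N : ℕ} (hf : IsRational f N) (hN : 1 ≤ N)
    {K : Set Sphere} (hK : K.Finite) : (f ⁻¹' K).Finite := by
  rw [← Set.biUnion_preimage_singleton]
  exact hK.biUnion fun w _ => hf.finite_fibre hN w

/-- Otherwise `f` is the identity, which forces `P = X * Q` with `Q` of degree `N - 1 ≥ 1`; a root
of `Q` is then a common zero of the two forms. -/
lemma IsRational.finite_fixedPoints {f : Sphere → Sphere} {N : ℕ} (hf : IsRational f N)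
    (hN : 2 ≤ N) : {z | f z = z}.Finite := by
  by_contra hinf
  have hid : f = fun z => (1 : Moebius) • z :=
    hf.eq_of_infinite (isRational_moebius 1) (by simpa using hinf)
  obtain ⟨P, Q, hf⟩ := hf
  have key : ∀ x y : ℂ, (x ≠ 0 ∨ y ≠ 0) → form N P x y * y = x * form N Q x y := by
    intro x y hxy
    have := hf.map_pt x y hxy
    rw [hid] at this
    simp only [one_smul] at this
    rw [pt_eq_pt_iff hxy (hf.ne_zero _ _ hxy)] at this
    exact this.symm
  have hQN : Q.coeff N = 0 := by
    have := key 1 0 (by simp)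
    simpa [form_zero_right] using this.symm
  have hPN : P.coeff N ≠ 0 := by
    have := hf.ne_zero 1 0 (by simp)
    simpa [form_zero_right, hQN] using this
  have hPQ : P = X * Q := by
    refine Polynomial.funext fun z => ?_
    have := key z 1 (by simp)
    rw [form_one hf.natDegree_left, form_one hf.natDegree_right] at this
    simpa using this
  have hQ0 : Q.coeff (N - 1) ≠ 0 := by
    obtain ⟨n, rfl⟩ : ∃ n, N = n + 1 := ⟨N - 1, by omega⟩
    rw [hPQ, coeff_X_mul] at hPN
    exact hPN
  obtain ⟨z, hz⟩ := IsAlgClosed.exists_root Q (by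
    intro h0
    have : Q.natDegree = 0 := natDegree_eq_of_degree_eq_some h0
    have := le_natDegree_of_ne_zero hQ0
    omega)
  have hzz := hf.ne_zero z 1 (by simp)
  rw [form_one hf.natDegree_left, form_one hf.natDegree_right, hPQ, eval_mul, hz.eq_zero] at hzz
  simp at hzz

/-- Total invariance of `∞` makes `Q` constant, so `f` is a polynomial map of degree `N ≥ 2`, and
subtracting `X * Q` does not affect the top coefficient. -/
lemma IsRational.exists_finite_fixedPoint {f : Sphere → Sphere} {N : ℕ} (hf : IsRational f N)
    (hN : 2 ≤ N) (h : ∀ z, f z = ∞ ↔ z = ∞) : ∃ z, z ≠ ∞ ∧ f z = z := by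
  obtain ⟨P, Q, hf⟩ := hf
  have hQN : Q.coeff N = 0 := by
    have := (h (pt 1 0)).2 (pt_zero_right 1)
    rw [hf.map_pt _ _ (by simp), pt_eq_infty_iff, form_zero_right] at this
    simpa using this
  have hPN : P.coeff N ≠ 0 := by
    have := hf.ne_zero 1 0 (by simp)
    simpa [form_zero_right, hQN] using this
  have hQ0 : Q.natDegree = 0 := by
    by_contra h0
    obtain ⟨z, hz⟩ := IsAlgClosed.exists_root Q (by
      intro h1
      exact h0 (natDegree_eq_of_degree_eq_some h1))
    have := (h (pt z 1)).1 (by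
      rw [hf.map_pt _ _ (by simp), pt_eq_infty_iff, form_one hf.natDegree_right]
      exact hz)
    rw [pt_eq_infty_iff] at this
    simp at this
  have hc : (P - X * Q).coeff N = P.coeff N := by
    obtain ⟨n, rfl⟩ : ∃ n, N = n + 1 := ⟨N - 1, by omega⟩
    rw [coeff_sub, coeff_X_mul, coeff_eq_zero_of_natDegree_lt (by omega : Q.natDegree < n), sub_zero]
  obtain ⟨z, hz⟩ := IsAlgClosed.exists_root (P - X * Q) (by
    intro h1
    have : (P - X * Q).natDegree = 0 := natDegree_eq_of_degree_eq_some h1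
    have := le_natDegree_of_ne_zero (hc ▸ hPN)
    omega)
  refine ⟨pt z 1, by rw [Ne, pt_eq_infty_iff]; simp, ?_⟩
  rw [hf.map_pt _ _ (by simp), pt_eq_pt_iff (hf.ne_zero _ _ (by simp)) (by simp),
    form_one hf.natDegree_left, form_one hf.natDegree_right]
  have := hz.eq_zero
  simp at this
  linear_combination this

/-- A form of degree `N` that vanishes at `[0 : 1]` only is a multiple of `x ^ N`. -/
lemma form_eq_of_only_zero {N : ℕ} {P : ℂ[X]} (hP : P.natDegree ≤ N)
    (h : ∀ x y : ℂ, (x ≠ 0 ∨ y ≠ 0) → form N P x y = 0 → x = 0) :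
    ∃ c : ℂ, c ≠ 0 ∧ ∀ x y, form N P x y = c * x ^ N := by
  have hPN : P.coeff N ≠ 0 := by
    intro h0
    have := h 1 0 (by simp) (by simp [form_zero_right, h0])
    simp at this
  have hd : P.natDegree = N := le_antisymm hP (le_natDegree_of_ne_zero hPN)
  have hP0 : P ≠ 0 := by rintro rfl; simp at hPN
  have hroots : P.roots = Multiset.replicate N 0 := by
    rw [Multiset.eq_replicate]
    refine ⟨?_, fun z hz => ?_⟩
    · rw [← hd]
      exact (IsAlgClosed.splits P).natDegree_eq_card_roots.symm
    · refine h z 1 (by simp) ?_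
      rw [form_one hP]
      exact (mem_roots hP0).1 hz
  have hPX : P = C (P.coeff N) * X ^ N := by
    have := (IsAlgClosed.splits P).eq_prod_roots
    rw [hroots] at this
    simpa [leadingCoeff, hd] using this
  refine ⟨P.coeff N, hPN, fun x y => ?_⟩
  generalize P.coeff N = c at hPX
  rw [hPX, form_C_mul, form, Finset.sum_range_succ, Finset.sum_eq_zero]
  · simp
  · intro i hi
    have := Finset.mem_range.1 hi
    rw [coeff_X_pow, if_neg (by omega)]
    simp

lemma form_eq_of_only_infty {N : ℕ} {P : ℂ[X]} (hP : P.natDegree ≤ N)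
    (h : ∀ x y : ℂ, (x ≠ 0 ∨ y ≠ 0) → form N P x y = 0 → y = 0) :
    ∃ c : ℂ, c ≠ 0 ∧ ∀ x y, form N P x y = c * y ^ N := by
  have hP0 : P.natDegree = 0 := by
    by_contra h0
    obtain ⟨z, hz⟩ := IsAlgClosed.exists_root P (by
      intro h1
      exact h0 (natDegree_eq_of_degree_eq_some h1))
    have := h z 1 (by simp) (by rw [form_one hP]; exact hz)
    simp at this
  rw [natDegree_eq_zero] at hP0
  obtain ⟨c, rfl⟩ := hP0
  refine ⟨c, ?_, fun x y => ?_⟩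
  · rintro rfl
    have := h 0 1 (by simp) (by simp [form])
    simp at this
  · rw [form, Finset.sum_range_succ', Finset.sum_eq_zero]
    · simp
    · intro i hi
      rw [coeff_C, if_neg (by omega)]
      simp

lemma IsRational.eq_pow {f : Sphere → Sphere} {N : ℕ} (hf : IsRational f N)
    (h0 : ∀ z, f z = ((0 : ℂ) : Sphere) → z = ((0 : ℂ) : Sphere)) (h1 : ∀ z, f z = ∞ → z = ∞) :
    ∃ c : ℂ, c ≠ 0 ∧ ∀ x y : ℂ, (x ≠ 0 ∨ y ≠ 0) → f (pt x y) = pt (c * x ^ N) (y ^ N) := by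
  obtain ⟨P, Q, hf⟩ := hf
  obtain ⟨a, ha, hPa⟩ := form_eq_of_only_zero hf.natDegree_left (fun x y hxy h => by
    rw [← pt_eq_zero_iff hxy]
    exact h0 _ (by rw [hf.map_pt _ _ hxy, pt_eq_zero_iff (hf.ne_zero _ _ hxy), h]))
  obtain ⟨b, hb, hQb⟩ := form_eq_of_only_infty hf.natDegree_right (fun x y hxy h => by
    rw [← pt_eq_infty_iff]
    exact h1 _ (by rw [hf.map_pt _ _ hxy, pt_eq_infty_iff, h]))
  refine ⟨a / b, div_ne_zero ha hb, fun x y hxy => ?_⟩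
  rw [hf.map_pt _ _ hxy, hPa, hQb, ← pt_mul_mul hb (a / b * x ^ N)]
  congr 1
  field_simp

lemma IsRational.eq_inv_pow {f : Sphere → Sphere} {N : ℕ} (hf : IsRational f N)
    (h0 : ∀ z, f z = ((0 : ℂ) : Sphere) → z = ∞) (h1 : ∀ z, f z = ∞ → z = ((0 : ℂ) : Sphere)) :
    ∃ c : ℂ, c ≠ 0 ∧ ∀ x y : ℂ, (x ≠ 0 ∨ y ≠ 0) → f (pt x y) = pt (c * y ^ N) (x ^ N) := by
  obtain ⟨P, Q, hf⟩ := hf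
  obtain ⟨a, ha, hPa⟩ := form_eq_of_only_infty hf.natDegree_left (fun x y hxy h => by
    rw [← pt_eq_infty_iff]
    exact h0 _ (by rw [hf.map_pt _ _ hxy, pt_eq_zero_iff (hf.ne_zero _ _ hxy), h]))
  obtain ⟨b, hb, hQb⟩ := form_eq_of_only_zero hf.natDegree_right (fun x y hxy h => by
    rw [← pt_eq_zero_iff hxy]
    exact h1 _ (by rw [hf.map_pt _ _ hxy, pt_eq_infty_iff, h]))
  refine ⟨a / b, div_ne_zero ha hb, fun x y hxy => ?_⟩
  rw [hf.map_pt _ _ hxy, hPa, hQb, ← pt_mul_mul hb (a / b * y ^ N)]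
  congr 1
  field_simp

/-! ### Leading terms of germs at `0` -/

open Filter Topology

/-- `u z ~ U z ^ s` as `z → 0`. -/
def Lead (u : ℂ → ℂ) (s : ℕ) (U : ℂ) : Prop :=
  Tendsto (fun z => u z / z ^ s) (𝓝[≠] 0) (𝓝 U)

namespace Lead

variable {u v : ℂ → ℂ} {s i : ℕ} {U V : ℂ}

lemma unique (h : Lead u s U) (h' : Lead u s V) : U = V := tendsto_nhds_unique h h'

lemma congr (h : Lead u s U) (huv : ∀ᶠ z in 𝓝 0, u z = v z) : Lead v s U := by
  refine Tendsto.congr' ?_ h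
  filter_upwards [nhdsWithin_le_nhds huv] with z hz
  rw [hz]

lemma add (h : Lead u s U) (h' : Lead v s V) : Lead (fun z => u z + v z) s (U + V) := by
  refine (Tendsto.add h h').congr fun z => ?_
  rw [add_div]

lemma const_mul (h : Lead u s U) (a : ℂ) : Lead (fun z => a * u z) s (a * U) := by
  refine (Tendsto.const_mul a h).congr fun z => ?_
  rw [mul_div_assoc]

lemma lower (h : Lead u s U) (hi : i < s) : Lead u i 0 := by
  have h1 : Tendsto (fun z : ℂ => z ^ (s - i)) (𝓝[≠] 0) (𝓝 0) := by
    have : Tendsto (fun z : ℂ => z ^ (s - i)) (𝓝 0) (𝓝 (0 ^ (s - i))) :=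
      (continuous_pow _).tendsto _
    rw [zero_pow (by omega)] at this
    exact this.mono_left nhdsWithin_le_nhds
  have h2 := Tendsto.mul h h1
  rw [mul_zero] at h2
  refine h2.congr' ?_
  filter_upwards [self_mem_nhdsWithin] with z hz
  have hz : z ≠ 0 := hz
  have e : z ^ s = z ^ i * z ^ (s - i) := by rw [← pow_add]; congr 1; omega
  rw [e]
  field_simp

/-- The coefficient in `Lead` may be zero; `Lead u s 0` then says that `u` vanishes to higher order
than `s`. -/
lemma order_lt (h : Lead u s 0) (h' : Lead u i U) (hU : U ≠ 0) : s < i := by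
  by_contra! hle
  rcases hle.eq_or_lt with rfl | hlt
  · exact hU (h'.unique h)
  · exact hU (h'.unique (h.lower hlt))

lemma tendsto_zero (h : Lead u s U) (hs : 1 ≤ s) : Tendsto u (𝓝[≠] 0) (𝓝 0) := by
  have := h.lower (i := 0) (by omega)
  simpa [Lead] using this

lemma tendsto_mul_punctured {ε : ℂ} (hε : ε ≠ 0) :
    Tendsto (fun z : ℂ => ε * z) (𝓝[≠] 0) (𝓝[≠] 0) := by
  refine tendsto_nhdsWithin_iff.2 ⟨?_, ?_⟩
  · have : Tendsto (fun z : ℂ => ε * z) (𝓝 0) (𝓝 (ε * 0)) := (continuous_const_mul ε).tendsto _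
    rw [mul_zero] at this
    exact this.mono_left nhdsWithin_le_nhds
  · filter_upwards [self_mem_nhdsWithin] with z hz
    exact mul_ne_zero hε hz

lemma scale (h : Lead u s U) {ε : ℂ} (hε : ε ≠ 0) : Lead (fun z => u (ε * z)) s (ε ^ s * U) := by
  refine ((Tendsto.comp h (tendsto_mul_punctured hε)).const_mul (ε ^ s)).congr fun z => ?_
  have := pow_ne_zero s hε
  simp only [Function.comp_apply, mul_pow]
  field_simp

lemma id : Lead (fun z => z) 1 1 := by
  refine Tendsto.congr' ?_ tendsto_const_nhds
  filter_upwards [self_mem_nhdsWithin] with z hz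
  have hz : z ≠ 0 := hz
  simp [hz]

lemma zero : Lead (fun _ => 0) s 0 := by
  simp [Lead]

end Lead

/-- `g w = w ^ S * G w` near `0` with `G` analytic and `G 0 = c`. -/
def HasOrder (g : ℂ → ℂ) (S : ℕ) (c : ℂ) : Prop :=
  ∃ G : ℂ → ℂ, AnalyticAt ℂ G 0 ∧ G 0 = c ∧ ∀ᶠ w in 𝓝 0, g w = w ^ S * G w

namespace HasOrder

variable {g u v b : ℂ → ℂ} {S s i : ℕ} {c U V a : ℂ}

lemma analyticAt (h : HasOrder g S c) : AnalyticAt ℂ g 0 := by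
  obtain ⟨G, hG, -, h⟩ := h
  exact (((analyticAt_id.pow S).mul hG)).congr (by filter_upwards [h] with w hw; simp [hw])

lemma apply_zero (h : HasOrder g S c) (hS : 1 ≤ S) : g 0 = 0 := by
  obtain ⟨G, hG, -, h⟩ := h
  rw [h.self_of_nhds, zero_pow (by omega), zero_mul]

lemma tendsto_zero (h : HasOrder g S c) (hS : 1 ≤ S) : Tendsto g (𝓝 0) (𝓝 0) := by
  have := h.analyticAt.continuousAt.tendsto
  rwa [h.apply_zero hS] at this

lemma exists_of_analyticAt (hg : AnalyticAt ℂ g 0) (h0 : ¬ ∀ᶠ z in 𝓝 0, g z = 0) :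
    ∃ S c, c ≠ 0 ∧ HasOrder g S c := by
  obtain ⟨n, G, hG, hG0, h⟩ := hg.exists_eventuallyEq_pow_smul_nonzero_iff.2 h0
  exact ⟨n, G 0, hG0, G, hG, rfl, by simpa using h⟩

/-- The leading term of `g ∘ u`. -/
lemma lead_comp (hg : HasOrder g S c) (hu : Lead u s U) (hs : 1 ≤ s) :
    Lead (fun z => g (u z)) (s * S) (c * U ^ S) := by
  obtain ⟨G, hG, rfl, hgG⟩ := hg
  have hu0 := hu.tendsto_zero hs
  have h1 := (hG.continuousAt.tendsto.comp hu0).mul (Tendsto.pow hu S)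
  refine Tendsto.congr' ?_ h1
  filter_upwards [hu0.eventually hgG] with z hz
  rw [hz, Function.comp_apply, div_pow, ← pow_mul]
  ring

lemma lead (hg : HasOrder g S c) : Lead g S c := by
  have := hg.lead_comp Lead.id le_rfl
  simpa using this

lemma comp (hg : HasOrder g S c) (hu : HasOrder u s a) (hs : 1 ≤ s) :
    HasOrder (g ∘ u) (s * S) (c * a ^ S) := by
  have hu0 := hu.tendsto_zero hs
  have hua := hu.analyticAt
  have hu1 := hu.apply_zero hs
  obtain ⟨G, hG, rfl, hgG⟩ := hg
  obtain ⟨H, hH, rfl, huH⟩ := hu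
  refine ⟨fun z => G (u z) * H z ^ S, (AnalyticAt.comp (by rwa [hu1]) hua).mul (hH.pow S),
    by simp only [hu1], ?_⟩
  filter_upwards [hu0.eventually hgG, huH] with z hz hz'
  rw [Function.comp_apply, hz]
  conv_lhs => rw [hz']
  conv_rhs => rw [hz']
  rw [mul_pow, pow_mul]
  ring

lemma iterate (hb : HasOrder b s c) (hs : 1 ≤ s) (hc : c ≠ 0) (r : ℕ) :
    ∃ c', c' ≠ 0 ∧ HasOrder b^[r] (s ^ r) c' := by
  induction r with
  | zero => exact ⟨1, one_ne_zero, fun _ => 1, analyticAt_const, rfl, by simp⟩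
  | succ r ih =>
    obtain ⟨c', hc', h⟩ := ih
    refine ⟨_, mul_ne_zero hc' (pow_ne_zero (s ^ r) hc), ?_⟩
    rw [Function.iterate_succ, pow_succ']
    exact h.comp hb hs

lemma iterate_one (hb : HasOrder b 1 c) (r : ℕ) : HasOrder b^[r] 1 (c ^ r) := by
  induction r with
  | zero => exact ⟨fun _ => 1, analyticAt_const, by simp, by simp⟩
  | succ r ih =>
    rw [Function.iterate_succ]
    simpa [pow_succ] using ih.comp hb le_rfl

/-- The leading term of `g (u + v) - g u` when `v` is small compared with `u`. -/
lemma lead_increment (hg : HasOrder g S c) (hu : Lead u s U) (hv : Lead v i V)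
    (hS : 1 ≤ S) (hs : 1 ≤ s) (hsi : s < i) :
    Lead (fun z => g (u z + v z) - g (u z)) (s * (S - 1) + i) (S * c * U ^ (S - 1) * V) := by
  obtain ⟨G, hG, rfl, hgG⟩ := hg
  have hu0 := hu.tendsto_zero hs
  have hv0 := hv.tendsto_zero (by omega)
  have huv0 : Tendsto (fun z => u z + v z) (𝓝[≠] 0) (𝓝 0) := by simpa using hu0.add hv0
  have huv : Lead (fun z => u z + v z) s U := by simpa using hu.add (hv.lower hsi)
  -- the increment of the power
  have h1 : Tendsto (fun z => (v z / z ^ i *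
      ∑ j ∈ Finset.range S, ((u z + v z) / z ^ s) ^ j * (u z / z ^ s) ^ (S - 1 - j)) *
        G (u z + v z)) (𝓝[≠] 0) (𝓝 ((V * ∑ j ∈ Finset.range S, U ^ j * U ^ (S - 1 - j)) * G 0)) :=
    (Tendsto.mul hv (tendsto_finsetSum _ fun j _ => (huv.pow j).mul (hu.pow _))).mul
      (hG.continuousAt.tendsto.comp huv0)
  -- the increment of the cofactor
  have hO := (hG.hasStrictFDerivAt.isBigO_sub).comp_tendsto (huv0.prodMk_nhds hu0)
  obtain ⟨K, hK⟩ := hO.bound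
  -- Strict differentiability bounds the increment of `G` by a constant times `‖v z‖`, so this
  -- contribution has a spare factor `z ^ s` and disappears in the limit.
  have h2 : Tendsto (fun z => (u z / z ^ s) ^ S * z ^ s * ((G (u z + v z) - G (u z)) / z ^ i))
      (𝓝[≠] 0) (𝓝 0) := by
    have h3 : Tendsto (fun z : ℂ => z ^ s) (𝓝[≠] 0) (𝓝 0) := by
      have : Tendsto (fun z : ℂ => z ^ s) (𝓝 0) (𝓝 (0 ^ s)) := (continuous_pow _).tendsto _
      rw [zero_pow (by omega)] at this
      exact this.mono_left nhdsWithin_le_nhds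
    have h4 : Tendsto (fun z => ‖(u z / z ^ s) ^ S * z ^ s‖ * (K * ‖v z / z ^ i‖))
        (𝓝[≠] 0) (𝓝 (‖U ^ S * 0‖ * (K * ‖V‖))) :=
      ((hu.pow S).mul h3).norm.mul (hv.norm.const_mul K)
    rw [mul_zero, norm_zero, zero_mul] at h4
    refine squeeze_zero_norm' ?_ h4
    filter_upwards [hK] with z hz
    rw [norm_mul]
    refine mul_le_mul_of_nonneg_left ?_ (norm_nonneg _)
    rw [norm_div, norm_div, ← mul_div_assoc]
    refine div_le_div_of_nonneg_right ?_ (norm_nonneg _)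
    simpa using hz
  have h5 := h1.add h2
  have hsum : ∑ j ∈ Finset.range S, U ^ j * U ^ (S - 1 - j) = S * U ^ (S - 1) := by
    rw [Finset.sum_congr rfl (g := fun _ => U ^ (S - 1)) (fun j hj => by
      rw [← pow_add]; congr 1; have := Finset.mem_range.1 hj; omega)]
    simp
  have hlim : (V * ∑ j ∈ Finset.range S, U ^ j * U ^ (S - 1 - j)) * G 0 + 0 =
      S * G 0 * U ^ (S - 1) * V := by rw [hsum]; ring
  rw [hlim] at h5
  refine Tendsto.congr' ?_ h5
  filter_upwards [self_mem_nhdsWithin, hu0.eventually hgG, huv0.eventually hgG] with z hz e1 e2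
  have hz : z ≠ 0 := hz
  rw [e1, e2]
  obtain ⟨n, rfl⟩ : ∃ n, S = n + 1 := ⟨S - 1, by omega⟩
  simp only [Nat.add_sub_cancel]
  have hgeom := geom_sum₂_mul (u z + v z) (u z) (n + 1)
  simp only [Nat.add_sub_cancel, add_sub_cancel_left] at hgeom
  have hsum' : ∑ j ∈ Finset.range (n + 1), ((u z + v z) / z ^ s) ^ j * (u z / z ^ s) ^ (n - j) =
      (∑ j ∈ Finset.range (n + 1), (u z + v z) ^ j * u z ^ (n - j)) / z ^ (s * n) := by
    rw [Finset.sum_div]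
    refine Finset.sum_congr rfl fun j hj => ?_
    have hj := Finset.mem_range.1 hj
    have e : s * n = s * j + s * (n - j) := by rw [← mul_add]; congr 1; omega
    rw [div_pow, div_pow, div_mul_div_comm, ← pow_mul, ← pow_mul, ← pow_add, ← e]
  rw [hsum']
  have e3 : (u z + v z) ^ (n + 1) * G (u z + v z) - u z ^ (n + 1) * G (u z) =
      v z * (∑ j ∈ Finset.range (n + 1), (u z + v z) ^ j * u z ^ (n - j)) * G (u z + v z) +
      u z ^ (n + 1) * (G (u z + v z) - G (u z)) := by
    linear_combination (-G (u z + v z)) * hgeom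
  rw [e3]
  rw [div_pow, ← pow_mul, show s * (n + 1) = s * n + s by ring, pow_add, pow_add]
  field_simp
  rw [pow_add]
  ring

/-- Here the outer function has only a leading term on the punctured neighbourhood, with `U = 0`
allowed. The condition `c ≠ 0` keeps `g z` away from `0`. -/
lemma comp_lead (hE : Lead u i U) (hg : HasOrder g S c) (hc : c ≠ 0) (hS : 1 ≤ S) :
    Lead (fun z => u (g z)) (S * i) (U * c ^ i) := by
  have hl := hg.lead
  have hne : ∀ᶠ z in 𝓝[≠] 0, g z ≠ 0 := by
    filter_upwards [Tendsto.eventually_ne hl hc] with z hz h0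
    simp [h0] at hz
  have hg0 : Tendsto g (𝓝[≠] 0) (𝓝[≠] 0) :=
    tendsto_nhdsWithin_iff.2 ⟨hl.tendsto_zero hS, hne⟩
  refine Tendsto.congr' ?_ ((Tendsto.comp hE hg0).mul (Tendsto.pow hl i))
  filter_upwards [hne] with z hz
  simp only [Function.comp_apply, div_pow, ← pow_mul]
  have := pow_ne_zero i hz
  field_simp

end HasOrder

/-! ### Descent of equivariance from an iterate of a germ to the germ -/

lemma tendsto_mul_nhds_zero (ε : ℂ) : Tendsto (fun z : ℂ => ε * z) (𝓝 0) (𝓝 0) := by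
  have : Tendsto (fun z : ℂ => ε * z) (𝓝 0) (𝓝 (ε * 0)) := (continuous_const_mul ε).tendsto _
  rwa [mul_zero] at this

lemma eventually_pow_scale {g : ℂ → ℂ} {ε : ℂ} {S : ℕ}
    (hg : ∀ᶠ z in 𝓝 0, g (ε * z) = ε ^ S * g z) (t : ℕ) :
    ∀ᶠ z in 𝓝 0, g (ε ^ t * z) = ε ^ (t * S) * g z := by
  induction t with
  | zero => simp
  | succ t ih =>
    filter_upwards [(tendsto_mul_nhds_zero (ε ^ t)).eventually hg, ih] with z h1 h2
    rw [pow_succ', mul_assoc, h1, h2]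
    ring

/-- The defect telescopes: passing from `ε ^ t` to `ε ^ (t + 1)` rescales the old defect,
multiplying its leading coefficient by `ε ^ (i - s)`, and adds `δ`. -/
lemma lead_scaling_defect {b : ℂ → ℂ} {s i : ℕ} {ε δ : ℂ} (hε : ε ≠ 0) (hi : s < i)
    (hD : Lead (fun z => (ε ^ s)⁻¹ * b (ε * z) - b z) i δ) (t : ℕ) :
    Lead (fun z => (ε ^ (s * t))⁻¹ * b (ε ^ t * z) - b z) i
      (δ * ∑ j ∈ Finset.range t, (ε ^ (i - s)) ^ j) := by
  induction t with
  | zero => simpa using Lead.zero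
  | succ t ih =>
    have h := ((ih.scale hε).const_mul (ε ^ s)⁻¹).add hD
    have e1 : (ε ^ s)⁻¹ * (ε ^ i * (δ * ∑ j ∈ Finset.range t, (ε ^ (i - s)) ^ j)) + δ =
        δ * ∑ j ∈ Finset.range (t + 1), (ε ^ (i - s)) ^ j := by
      rw [geom_sum_succ]
      have : ε ^ i = ε ^ s * ε ^ (i - s) := by rw [← pow_add]; congr 1; omega
      have h0 := pow_ne_zero s hε
      rw [this]
      field_simp
    rw [e1] at h
    refine h.congr (Eventually.of_forall fun z => ?_)
    have h1 := pow_ne_zero s hε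
    have h2 := pow_ne_zero (s * t) hε
    rw [show ε ^ t * (ε * z) = ε ^ (t + 1) * z by ring, show s * (t + 1) = s * t + s by ring, pow_add]
    field_simp
    ring

/-- If an iterate of a germ `b`, none of whose iterates is the identity, is equivariant with respect
to multiplication by `ε`, then so is `b`. -/
theorem scaling_of_iterate_scaling {b : ℂ → ℂ} {s : ℕ} {c ε : ℂ} (hs : 1 ≤ s) (hc : c ≠ 0)
    (hb : HasOrder b s c) (hid : ∀ t, 1 ≤ t → ¬ ∀ᶠ z in 𝓝 0, b^[t] z = z) (hε : ε ≠ 0) {r m : ℕ}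
    (hr : 1 ≤ r) (hg : ∀ᶠ z in 𝓝 0, b^[r] (ε * z) = ε ^ m * b^[r] z) :
    ∀ᶠ z in 𝓝 0, b (ε * z) = ε ^ s * b z := by
  have hεs := pow_ne_zero s hε
  obtain ⟨C, hC, hgC⟩ := hb.iterate hs hc r
  -- the multiplier
  have hm : ε ^ m = ε ^ (s ^ r) := by
    have h1 := (hgC.lead.scale hε).unique ((hgC.lead.const_mul (ε ^ m)).congr
      (by filter_upwards [hg] with z hz; rw [hz]))
    exact (mul_right_cancel₀ hC h1).symm
  rw [hm] at hg
  have hmulA : AnalyticAt ℂ (fun z : ℂ => ε * z) 0 := analyticAt_const.mul analyticAt_id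
  have hDA : AnalyticAt ℂ (fun z => (ε ^ s)⁻¹ * b (ε * z) - b z) 0 :=
    (analyticAt_const.mul (AnalyticAt.comp (by simpa using hb.analyticAt) hmulA)).sub hb.analyticAt
  by_contra hcon
  obtain ⟨i, δ, hδ, hD⟩ := HasOrder.exists_of_analyticAt hDA (fun h => hcon (by
    filter_upwards [h] with z hz
    field_simp at hz
    linear_combination hz))
  set D : ℂ → ℂ := fun z => (ε ^ s)⁻¹ * b (ε * z) - b z with hDdef
  have hbD : ∀ z, b (ε * z) = ε ^ s * (b z + D z) := by
    intro z
    simp only [hDdef]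
    field_simp
    ring
  -- The leading terms of the two summands of `D` cancel.
  have hi : s < i := by
    refine Lead.order_lt ?_ hD.lead hδ
    have h := ((hb.lead.scale hε).const_mul (ε ^ s)⁻¹).add (hb.lead.const_mul (-1))
    have e : (ε ^ s)⁻¹ * (ε ^ s * c) + -1 * c = 0 := by field_simp; ring
    rw [e] at h
    refine h.congr (Eventually.of_forall fun z => ?_)
    simp only [hDdef]
    ring
  have hE := fun t => lead_scaling_defect hε hi hD.lead t
  have hb0 := hb.tendsto_zero hs
  have hD0 := hD.tendsto_zero (by omega)
  have hbD0 : Tendsto (fun z => b z + D z) (𝓝 0) (𝓝 0) := by simpa using hb0.add hD0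
  have hcomm : ∀ (q : ℕ) z, b (b^[q] z) = b^[q] (b z) := fun q z => by
    rw [← Function.iterate_succ_apply' b q z, Function.iterate_succ_apply]
  -- compare `b ∘ g` and `g ∘ b` at `ε z`
  have key : ∀ q : ℕ, (∀ᶠ z in 𝓝 0, b^[q] (ε * z) = ε ^ (s ^ q) * b^[q] z) →
      ∀ᶠ z in 𝓝 0, (ε ^ (s * s ^ q))⁻¹ * b (ε ^ (s ^ q) * b^[q] z) - b (b^[q] z) =
        b^[q] (b z + D z) - b^[q] (b z) := by
    intro q hq
    filter_upwards [hq, hbD0.eventually (eventually_pow_scale hq s)] with z h1 h2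
    rw [← h1, hcomm, hcomm, hbD, h2]
    have := pow_ne_zero (s * s ^ q) hε
    field_simp
  have hkey := key r hg
  -- The left side of `hkey` has order at least `s ^ r * i`, its coefficient being possibly zero;
  -- the right side has order exactly `s * (s ^ r - 1) + i`.
  have hL := (HasOrder.comp_lead (hE (s ^ r)) hgC hC (Nat.one_le_pow _ _ hs)).congr hkey
  have hR := hgC.lead_increment hb.lead hD.lead (Nat.one_le_pow _ _ hs) hs hi
  have hSne : ((s ^ r : ℕ) : ℂ) ≠ 0 := by exact_mod_cast (pow_pos hs r).ne'
  rcases hs.eq_or_lt with rfl | hs2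
  · -- multiplier different from zero
    simp only [one_pow, Finset.sum_range_one, pow_zero, pow_one, mul_one, Nat.cast_one, one_mul] at *
    have hgC' := hb.iterate_one r
    have hCc : C = c ^ r := hgC.lead.unique hgC'.lead
    have h1 : δ * C ^ i = C * δ := by
      refine hL.unique ?_
      simpa using hR
    have hC1 : C ^ (i - 1) = 1 := by
      obtain ⟨n, rfl⟩ : ∃ n, i = n + 1 := ⟨i - 1, by omega⟩
      have : C * δ * (C ^ n - 1) = 0 := by linear_combination h1
      have := (mul_eq_zero.1 this).resolve_left (mul_ne_zero hC hδ)
      simpa using sub_eq_zero.1 this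
    -- The multiplier `C` of `b^[r]` satisfies `C ^ (i - 1) = 1`, so `b^[q]` is tangent to the
    -- identity. It is not the identity, hence is `z + a z ^ j + ...` with `j > 1`.
    set q := r * (i - 1) with hq
    have hq1 : 1 ≤ q := Nat.mul_pos hr (by omega)
    have hg1 : HasOrder b^[q] 1 1 := by
      have := hb.iterate_one q
      rwa [hq, pow_mul, ← hCc, hC1] at this
    have hscale : ∀ᶠ z in 𝓝 0, b^[q] (ε * z) = ε * b^[q] z := by
      have hall : ∀ k : ℕ, ∀ᶠ z in 𝓝 0, b^[r * k] (ε * z) = ε * b^[r * k] z := by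
        intro k
        induction k with
        | zero => simp
        | succ k ih =>
          have h0 : Tendsto b^[r] (𝓝 0) (𝓝 0) := hgC'.tendsto_zero le_rfl
          filter_upwards [hg, h0.eventually ih] with z e1 e2
          rw [mul_add, mul_one, Function.iterate_add_apply, e1, e2, ← Function.iterate_add_apply]
      exact hall _
    have hγA : AnalyticAt ℂ (fun z => b^[q] z - z) 0 := hg1.analyticAt.sub analyticAt_id
    obtain ⟨j, a, ha, hγ⟩ := HasOrder.exists_of_analyticAt hγA (fun h => hid q hq1 (by
      filter_upwards [h] with z hz
      linear_combination hz))
    have hj : 1 < j := by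
      refine Lead.order_lt ?_ hγ.lead ha
      have h := hg1.lead.add (Lead.id.const_mul (-1))
      rw [mul_one, add_neg_cancel] at h
      refine h.congr (Eventually.of_forall fun z => ?_)
      ring
    have hgγ : ∀ z, b^[q] z = z + (b^[q] z - z) := fun z => by ring
    -- `b` commutes with `z + γ z`
    have hcj : c ^ (j - 1) = 1 := by
      have h2 := hb.lead_increment Lead.id hγ.lead le_rfl le_rfl hj
      have h3 := hγ.lead_comp hb.lead le_rfl
      have h4 := h2.unique (Lead.congr (by simpa using h3) (Eventually.of_forall fun z => by
        rw [← hcomm, ← hgγ]))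
      obtain ⟨n, rfl⟩ : ∃ n, j = n + 1 := ⟨j - 1, by omega⟩
      have : c * a * (c ^ n - 1) = 0 := by
        simp at h4
        linear_combination -h4
      have := (mul_eq_zero.1 this).resolve_left (mul_ne_zero hc ha)
      simpa using sub_eq_zero.1 this
    -- By `key`, `D (z + γ) - D z = γ (b + D) - γ b` with `γ z = b^[q] z - z`. The leading
    -- coefficients are `i δ a` and `j a δ`, in the same order `i + j - 1`.
    have hij : i = j := by
      have h2 := hD.lead_increment Lead.id hγ.lead hi.le le_rfl hj
      have h3 := hγ.lead_increment hb.lead hD.lead hj.le le_rfl hi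
      have hk := key q hscale
      have h4 : Lead (fun z => D (z + (b^[q] z - z)) - D z) (1 * (j - 1) + i)
          (j * a * c ^ (j - 1) * δ) := by
        refine h3.congr ?_
        filter_upwards [hk] with z hz
        have e1 : D (z + (b^[q] z - z)) = b^[q] (b z + D z) - b^[q] (b z) := by
          rw [← hz, ← hgγ, hDdef]
        rw [e1]
        ring
      have hexp : 1 * (j - 1) + i = 1 * (i - 1) + j := by omega
      rw [hexp] at h4
      have h5 := h2.unique h4
      rw [hcj] at h5
      have h6 : ((i : ℂ) - j) * (δ * a) = 0 := by
        simp at h5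
        linear_combination h5
      have h7 := (mul_eq_zero.1 h6).resolve_right (mul_ne_zero hδ ha)
      exact_mod_cast sub_eq_zero.1 h7
    subst hij
    have hεi : ε ^ (i - 1) = 1 := by
      have h2 := (hγ.lead.scale hε).unique ((hγ.lead.const_mul ε).congr (by
        filter_upwards [hscale] with z hz
        rw [hz]; ring))
      obtain ⟨n, rfl⟩ : ∃ n, i = n + 1 := ⟨i - 1, by omega⟩
      have : ε * a * (ε ^ n - 1) = 0 := by linear_combination h2
      have := (mul_eq_zero.1 this).resolve_left (mul_ne_zero hε ha)
      simpa using sub_eq_zero.1 this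
    -- Since `ε ^ (i - 1) = 1`, the defect of `ε ^ (i - 1)` is zero, while its geometric sum gives
    -- the coefficient `(i - 1) δ`.
    have h2 := (hE (i - 1)).unique (Lead.zero.congr (Eventually.of_forall fun z => by
      rw [hεi]; simp))
    rw [hεi] at h2
    have hi1 : ((i - 1 : ℕ) : ℂ) ≠ 0 := by
      have : i - 1 ≠ 0 := by omega
      exact_mod_cast this
    simp [hδ, hi1] at h2
  · -- multiplier zero
    have hS2 : 2 ≤ s ^ r := (Nat.succ_le_of_lt hs2).trans (Nat.le_self_pow (Nat.one_le_iff_ne_zero.1 hr) s)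
    -- This is `s * (S - 1) < (S - 1) * i` for `S = s ^ r ≥ 2`; the nonzero term on the right of
    -- `hkey` therefore has no counterpart on the left.
    have hlt : s * (s ^ r - 1) + i < s ^ r * i := by
      obtain ⟨n, hn⟩ : ∃ n, s ^ r = n + 1 := ⟨s ^ r - 1, by omega⟩
      rw [hn]
      have : s * n < n * i := by
        rw [mul_comm]
        exact Nat.mul_lt_mul_of_pos_left hi (by omega)
      simp only [Nat.add_sub_cancel]
      nlinarith
    have h0 := (hL.lower hlt).unique hR
    exact (mul_ne_zero (mul_ne_zero (mul_ne_zero hSne hC) (pow_ne_zero _ hc)) hδ) h0.symm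

/-! ### Orbits of finite groups of Möbius transformations -/

/-- The points of the sphere with a nontrivial stabilizer in `H`. -/
def ramifiedPoints (H : Subgroup Moebius) : SubMulAction H Sphere where
  carrier := {z | ∃ h : H, h ≠ 1 ∧ h • z = z}
  smul_mem' := by
    rintro g z ⟨h, h1, hz⟩
    refine ⟨g * h * g⁻¹, fun hc => h1 ?_, ?_⟩
    · simpa [mul_inv_eq_one] using hc
    · rw [mul_smul, mul_smul, inv_smul_smul, hz]

lemma orderOf_pos_of_mem {H : Subgroup Moebius} [Finite H] (h : H) :
    0 < orderOf (h : Moebius) := by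
  rw [Subgroup.orderOf_coe]
  exact orderOf_pos h

lemma finite_ramifiedPoints (H : Subgroup Moebius) [Finite H] : Finite (ramifiedPoints H) := by
  have : {z : Sphere | ∃ h : H, h ≠ 1 ∧ h • z = z} ⊆
      ⋃ h : {h : H // h ≠ 1}, {z : Sphere | (h : H) • z = z} := by
    rintro z ⟨h, h1, hz⟩
    exact Set.mem_iUnion.2 ⟨⟨h, h1⟩, hz⟩
  refine Set.Finite.subset (Set.finite_iUnion fun h => ?_) this
  obtain ⟨p, q, -, hpq⟩ := moebius_fixedPoints (orderOf_pos_of_mem (h : H))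
    (fun hc => h.2 (Subtype.ext hc))
  refine (Set.toFinite {p, q}).subset fun z hz => ?_
  simpa using (hpq z).1 hz

/-- The orbit counting inequality, for a group of order `N` and an orbit of length `n₀` with
stabilizers of order at least `6`. -/
lemma orbit_length_le_two {ι : Type*} [Fintype ι] [DecidableEq ι] (n e : ι → ℕ) (N c : ℕ)
    (hne : ∀ i, n i * e i = N) (he : ∀ i, 2 ≤ e i) (i₀ : ι) (hi₀ : 6 ≤ e i₀) (hN : 0 < N)
    (hsum : c = ∑ i, n i) (hburnside : c + 2 * (N - 1) = Fintype.card ι * N) : n i₀ ≤ 2 := by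
  have h2 : ∀ i, 2 * n i ≤ N := fun i => by
    rw [← hne i, mul_comm]
    exact Nat.mul_le_mul_left _ (he i)
  have h6 : 6 * n i₀ ≤ N := by
    rw [← hne i₀, mul_comm]
    exact Nat.mul_le_mul_left _ hi₀
  have hn0 : 1 ≤ n i₀ := Nat.pos_of_ne_zero fun h => by have := hne i₀; simp [h] at this; omega
  rw [← Finset.add_sum_erase _ _ (Finset.mem_univ i₀)] at hsum
  have hcard : (Finset.univ.erase i₀).card = Fintype.card ι - 1 := by
    rw [Finset.card_erase_of_mem (Finset.mem_univ _), Finset.card_univ]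
  have hpos : 1 ≤ Fintype.card ι := Fintype.card_pos_iff.2 ⟨i₀⟩
  obtain ⟨q, hq⟩ : ∃ q, Fintype.card ι = q + 1 := ⟨Fintype.card ι - 1, by omega⟩
  rw [hq] at hburnside hcard
  simp only [Nat.add_sub_cancel] at hcard
  have hle : 2 * ∑ i ∈ Finset.univ.erase i₀, n i ≤ q * N := by
    rw [Finset.mul_sum, ← hcard]
    exact Finset.sum_le_card_nsmul _ _ _ fun i _ => h2 i
  -- With `n i₀ ≤ N / 6` and the other `q` orbits of length at most `N / 2`, the count gives `q / 2
  -- < 1 + 1 / 6`.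
  have hq2 : q ≤ 2 := by
    by_contra! h
    have h3 : 3 * N ≤ q * N := Nat.mul_le_mul_right _ h
    have : (q + 1) * N = q * N + N := by ring
    omega
  interval_cases q
  · omega
  · omega
  -- Now `n i₀ + n a + n b = N + 2`. If `e a` or `e b` were at least `3`, the left side would be at
  -- most `N / 6 + N / 3 + N / 2 = N`. So both are `2` and `n i₀ = 2`.
  · obtain ⟨a, b, hab, hs⟩ := Finset.card_eq_two.1 hcard
    rw [hs, Finset.sum_pair hab] at hsum
    by_contra! h
    have ha := h2 a
    have hb := h2 b
    have h3 : ∀ i, 3 ≤ e i → 3 * n i ≤ N := fun i hi => by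
      rw [← hne i, mul_comm]
      exact Nat.mul_le_mul_left _ hi
    have h3a := h3 a
    have h3b := h3 b
    have hea := he a
    have heb := he b
    by_cases h1 : 3 ≤ e a
    · have := h3a h1
      omega
    · by_cases h1' : 3 ≤ e b
      · have := h3b h1'
        omega
      · have e1 := hne a
        have e2 := hne b
        rw [show e a = 2 by omega] at e1
        rw [show e b = 2 by omega] at e2
        omega

open MulAction in
/-- In a finite group of Möbius transformations, a fixed point of an element of order greater
than `5` has an orbit contained in the set of fixed points of that element. -/
lemma orbit_subset_fixedPoints {H : Subgroup Moebius} [Finite H] {σ : Moebius} (hσH : σ ∈ H)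
    (hσ : 5 < orderOf σ) {z₀ : Sphere} (hσ₀ : σ • z₀ = z₀) {τ : Moebius} (hτ : τ ∈ H) :
    τ • z₀ = z₀ ∨ σ • τ • z₀ = τ • z₀ := by
  classical
  have := finite_ramifiedPoints H
  let _ : Fintype H := Fintype.ofFinite H
  let _ : Fintype (ramifiedPoints H) := Fintype.ofFinite _
  let _ : ∀ g : H, Fintype (fixedBy (ramifiedPoints H) g) := fun g => Fintype.ofFinite _
  let _ : ∀ z : ramifiedPoints H, Fintype (stabilizer H z) := fun g => Fintype.ofFinite _
  let _ : Fintype (orbitRel.Quotient H (ramifiedPoints H)) := Fintype.ofFinite _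
  set s : H := ⟨σ, hσH⟩ with hs
  have hsord : orderOf s = orderOf σ := (Subgroup.orderOf_coe s).symm
  have hs1 : s ≠ 1 := fun h => by rw [h, orderOf_one] at hsord; omega
  let p₀ : ramifiedPoints H := ⟨z₀, s, hs1, hσ₀⟩
  let ω₀ : orbitRel.Quotient H (ramifiedPoints H) := Quotient.mk'' p₀
  -- Orbit representatives are chosen so that the orbit of `z₀` is represented by `z₀` itself.
  let φ : orbitRel.Quotient H (ramifiedPoints H) → ramifiedPoints H :=
    Function.update Quotient.out ω₀ p₀
  have hφ₀ : φ ω₀ = p₀ := Function.update_self _ _ _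
  have hφ : Function.LeftInverse Quotient.mk'' φ := fun ω => by
    by_cases h : ω = ω₀
    · rw [h, hφ₀]
    · simp only [φ, Function.update_of_ne h, Quotient.out_eq']
  have hclass := card_eq_sum_card_group_div_card_stabilizer' H (ramifiedPoints H) hφ
  have hburnside := sum_card_fixedBy_eq_card_orbits_mul_card_group H (ramifiedPoints H)
  have hfix1 : Fintype.card (fixedBy (ramifiedPoints H) (1 : H)) =
      Fintype.card (ramifiedPoints H) :=
    Fintype.card_congr ((Equiv.setCongr (by ext; simp)).trans (Equiv.Set.univ _))
  have hfix2 : ∀ g : H, g ≠ 1 → Fintype.card (fixedBy (ramifiedPoints H) g) = 2 := by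
    intro g hg
    obtain ⟨p, q, hpq, h⟩ := moebius_fixedPoints (orderOf_pos_of_mem g)
      (fun hc => hg (Subtype.ext hc))
    have hp : p ∈ ramifiedPoints H := ⟨g, hg, (h p).2 (Or.inl rfl)⟩
    have hq : q ∈ ramifiedPoints H := ⟨g, hg, (h q).2 (Or.inr rfl)⟩
    have hset : fixedBy (ramifiedPoints H) g = {⟨p, hp⟩, ⟨q, hq⟩} := by
      ext ⟨z, hz⟩
      simp only [mem_fixedBy, Set.mem_insert_iff, Set.mem_singleton_iff, Subtype.ext_iff]
      exact h z
    rw [← Nat.card_eq_fintype_card, Nat.card_coe_set_eq, hset, Set.ncard_pair]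
    simpa using hpq
  -- In Burnside's sum the identity fixes every ramified point, and each other element fixes exactly
  -- two.
  rw [← Finset.add_sum_erase _ _ (Finset.mem_univ (1 : H)), hfix1,
    Finset.sum_congr rfl (fun g hg => hfix2 g (Finset.ne_of_mem_erase hg)), Finset.sum_const,
    Finset.card_erase_of_mem (Finset.mem_univ _), Finset.card_univ, smul_eq_mul, mul_comm _ 2]
    at hburnside
  have horbit : Fintype.card H / Fintype.card (stabilizer H p₀) ≤ 2 := by
    have := orbit_length_le_two
      (fun ω => Fintype.card H / Fintype.card (stabilizer H (φ ω)))
      (fun ω => Fintype.card (stabilizer H (φ ω))) (Fintype.card H) _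
      (fun ω => Nat.div_mul_cancel (by
        rw [← Nat.card_eq_fintype_card, ← Nat.card_eq_fintype_card]
        exact Subgroup.card_subgroup_dvd_card _))
      (fun ω => by
        obtain ⟨⟨z, h, h1, hz⟩, hzω⟩ : ∃ x, φ ω = x := ⟨_, rfl⟩
        rw [hzω]
        refine Fintype.one_lt_card_iff.2 ⟨⟨h, Subtype.ext hz⟩, 1, fun hc => h1 ?_⟩
        exact congrArg Subtype.val hc)
      ω₀
      (by
        rw [hφ₀, ← Nat.card_eq_fintype_card]
        refine (Nat.succ_le_of_lt (hsord ▸ hσ)).trans ?_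
        rw [← Nat.card_zpowers]
        refine Subgroup.card_le_of_le ?_
        rw [Subgroup.zpowers_le]
        exact Subtype.ext hσ₀)
      Fintype.card_pos hclass hburnside
    simpa only [hφ₀] using this
  let _ : Fintype (orbit H p₀) := Fintype.ofFinite _
  have horb := card_orbit_mul_card_stabilizer_eq_card_group H p₀
  have hle : Fintype.card (orbit H p₀) ≤ 2 := by
    rwa [← horb, Nat.mul_div_cancel _ Fintype.card_pos] at horbit
  by_contra! hcon
  obtain ⟨h1, h2⟩ := hcon
  set t : H := ⟨τ, hτ⟩ with ht
  -- Otherwise `z₀`, `τ z₀` and `σ τ z₀` are three distinct points of the orbit.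
  refine absurd hle (not_le.2 (Fintype.two_lt_card_iff.2 ⟨⟨p₀, mem_orbit_self _⟩,
    ⟨t • p₀, mem_orbit _ _⟩, ⟨(s * t) • p₀, mem_orbit _ _⟩, fun h => h1 ?_, fun h => h1 ?_,
    fun h => h2 ?_⟩))
  · have := congrArg Subtype.val (congrArg Subtype.val h)
    exact this.symm
  · have : z₀ = σ • τ • z₀ := by
      have := congrArg Subtype.val (congrArg Subtype.val h)
      exact this.trans (mul_smul s t z₀)
    have h3 : σ • z₀ = σ • τ • z₀ := hσ₀.trans this
    exact ((smul_left_cancel_iff _).1 h3).symm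
  · have : τ • z₀ = σ • τ • z₀ := by
      have := congrArg Subtype.val (congrArg Subtype.val h)
      exact this.trans (mul_smul s t z₀)
    exact this.symm

lemma smul_eq_or_eq_of_mem {H : Subgroup Moebius} [Finite H] {σ : Moebius} (hσH : σ ∈ H)
    (hσ : 5 < orderOf σ) {z₀ z₁ : Sphere} (hne : z₀ ≠ z₁) (hσ₀ : σ • z₀ = z₀)
    (hσ₁ : σ • z₁ = z₁) {τ : Moebius} (hτ : τ ∈ H) : τ • z₀ = z₀ ∨ τ • z₀ = z₁ := by
  rcases orbit_subset_fixedPoints hσH hσ hσ₀ hτ with h | h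
  · exact Or.inl h
  · by_contra! hc
    have := moebius_eq_one_of_fixes_three hne hc.1.symm hc.2.symm hσ₀ hσ₁ h
    rw [this, orderOf_one] at hσ
    omega

/-! ### Finiteness of the groups `Σ(f)` and `Aut(f)` -/

lemma zero_ne_infty : ((0 : ℂ) : Sphere) ≠ ∞ := OnePoint.coe_ne_infty 0

/-- A set of Möbius transformations that map three given points into a finite set is finite. -/
lemma finite_of_maps_three {T : Set Moebius} {p q r : Sphere} (hpq : p ≠ q) (hpr : p ≠ r)
    (hqr : q ≠ r) {K : Set Sphere} (hK : K.Finite)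
    (h : ∀ τ ∈ T, τ • p ∈ K ∧ τ • q ∈ K ∧ τ • r ∈ K) : T.Finite := by
  refine Set.Finite.of_finite_image (f := fun τ : Moebius => (τ • p, τ • q, τ • r))
    ((hK.prod (hK.prod hK)).subset ?_) ?_
  · rintro _ ⟨τ, hτ, rfl⟩
    exact h τ hτ
  · intro τ _ τ' _ he
    simp only [Prod.mk.injEq] at he
    have : τ'⁻¹ * τ = 1 := moebius_eq_one_of_fixes_three hpq hpr hqr
      (by rw [mul_smul, he.1, inv_smul_smul]) (by rw [mul_smul, he.2.1, inv_smul_smul])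
      (by rw [mul_smul, he.2.2, inv_smul_smul])
    exact (inv_mul_eq_one.1 this).symm

lemma IsRational.finite_symSigma {f : Sphere → Sphere} {N : ℕ} (hf : IsRational f N)
    (hN : 1 ≤ N) : Finite (symSigma f) := by
  have h01 : ((0 : ℂ) : Sphere) ≠ ((1 : ℂ) : Sphere) := by simp
  refine Set.Finite.to_subtype (finite_of_maps_three h01 zero_ne_infty (OnePoint.coe_ne_infty 1)
    (hf.finite_preimage hN (Set.toFinite
      {f ((0 : ℂ) : Sphere), f ((1 : ℂ) : Sphere), f ∞})) fun τ hτ => ?_)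
  have hτ : ∀ z, f (τ • z) = f z := hτ
  simp [hτ]

lemma IsRational.exists_other_fixedPoint {f : Sphere → Sphere} {N : ℕ} (hf : IsRational f N)
    (hN : 2 ≤ N) {z₀ : Sphere} (h : ∀ z, f z = z₀ ↔ z = z₀) : ∃ w, w ≠ z₀ ∧ f w = w := by
  obtain ⟨r, hr⟩ : ∃ r : Sphere, r ≠ z₀ := exists_ne z₀
  obtain ⟨β, -, h1⟩ := exists_moebius_zero_infty hr
  have hz₀ : z₀ = β⁻¹ • (∞ : Sphere) := by rw [← h1, inv_smul_smul]
  obtain ⟨w, hw, hfw⟩ := (hf.conj β).exists_finite_fixedPoint hN (fun z => by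
    rw [smul_eq_iff_eq_inv_smul, ← hz₀, h, inv_smul_eq_iff, h1])
  refine ⟨β⁻¹ • w, fun hc => hw ?_, ?_⟩
  · rwa [inv_smul_eq_iff, h1] at hc
  · rwa [eq_inv_smul_iff]

/-- The automorphism group of a rational map with a fixed point `z₀` is finite, unless `z₀` and
another point are both totally invariant. -/
lemma IsRational.finite_symAut {f : Sphere → Sphere} {N : ℕ} (hf : IsRational f N) (hN : 2 ≤ N)
    {z₀ : Sphere} (hz₀ : f z₀ = z₀)
    (h : ∀ w, w ≠ z₀ → ¬ ((∀ z, f z = z₀ ↔ z = z₀) ∧ ∀ z, f z = w ↔ z = w)) :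
    Finite (symAut f) := by
  -- Commuting with `f` preserves the condition that the second image be fixed, so three such points
  -- suffice.
  have hK : {z | f (f (f z)) = f (f z)}.Finite :=
    hf.finite_preimage (by omega) (hf.finite_preimage (by omega) (hf.finite_fixedPoints hN))
  suffices ∃ p q r : Sphere, p ≠ q ∧ p ≠ r ∧ q ≠ r ∧ f (f (f p)) = f (f p) ∧
      f (f (f q)) = f (f q) ∧ f (f (f r)) = f (f r) by
    obtain ⟨p, q, r, hpq, hpr, hqr, hp, hq, hr⟩ := this
    refine Set.Finite.to_subtype (finite_of_maps_three hpq hpr hqr hK fun τ hτ => ?_)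
    have hτ : ∀ z, f (τ • z) = τ • f z := hτ
    simp only [Set.mem_ofPred_eq, hτ, hp, hq, hr, and_self]
  have hsurj := hf.surjective (by omega)
  -- A second preimage `w` of `z₀` and a preimage of `w` complete the triple. If there is none, `z₀`
  -- is totally invariant, another fixed point `w` exists, and by `h` it has a second preimage.
  by_cases h1 : ∃ w, w ≠ z₀ ∧ f w = z₀
  · obtain ⟨w, hw, hfw⟩ := h1
    obtain ⟨v, hv⟩ := hsurj w
    refine ⟨z₀, w, v, hw.symm, ?_, ?_, ?_, ?_, ?_⟩
    · rintro rfl; exact hw (hv.symm.trans hz₀)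
    · rintro rfl; exact hw (hv.symm.trans hfw)
    all_goals simp [hz₀, hfw, hv]
  · have hti : ∀ z, f z = z₀ ↔ z = z₀ :=
      fun z => ⟨fun hz => by_contra fun hc => h1 ⟨z, hc, hz⟩, fun hz => by rw [hz, hz₀]⟩
    obtain ⟨w, hw, hfw⟩ := hf.exists_other_fixedPoint hN hti
    by_cases h2 : ∃ v, v ≠ w ∧ f v = w
    · obtain ⟨v, hv, hfv⟩ := h2
      refine ⟨z₀, w, v, hw.symm, ?_, hv.symm, ?_, ?_, ?_⟩
      · rintro rfl; exact hw (hfv.symm.trans hz₀)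
      all_goals simp [hz₀, hfw, hfv]
    · exact absurd ⟨hti, fun z => ⟨fun hz => by_contra fun hc => h2 ⟨z, hc, hz⟩,
        fun hz => by rw [hz, hfw]⟩⟩ (h w hw)

/-! ### Totally invariant pairs and conjugacy to powers -/

/-- If `0` and `∞` are totally invariant for an iterate of `f`, then `f` fixes or exchanges them
and they have no other preimages. -/
lemma IsRational.totally_invariant_of_iterate {f : Sphere → Sphere} {n : ℕ} (hf : IsRational f n)
    (hn : 2 ≤ n) {m : ℕ} (hm : 1 ≤ m)
    (h0 : ∀ z, f^[m] z = ((0 : ℂ) : Sphere) ↔ z = ((0 : ℂ) : Sphere))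
    (h1 : ∀ z, f^[m] z = ∞ ↔ z = ∞) :
    ((∀ z, f z = ((0 : ℂ) : Sphere) → z = ((0 : ℂ) : Sphere)) ∧ ∀ z, f z = ∞ → z = ∞) ∨
    ((∀ z, f z = ((0 : ℂ) : Sphere) → z = ∞) ∧ ∀ z, f z = ∞ → z = ((0 : ℂ) : Sphere)) := by
  have hsurj := hf.surjective (by omega)
  obtain ⟨c, hc, hB⟩ := (hf.iterate m).eq_pow (fun z => (h0 z).1) (fun z => (h1 z).1)
  have hNpos : n ^ m ≠ 0 := pow_ne_zero _ (by omega)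
  have hN2 : 1 < n ^ m := Nat.one_lt_pow (by omega) hn
  -- Points of the fibre over `p` are lifted through the surjective `f^[m - 1]`; both lifts must be
  -- `p`.
  have huniq : ∀ p, (∀ z, f^[m] z = p ↔ z = p) → ∀ a b, f a = p → f b = p → a = b := by
    intro p hp a b ha hb
    obtain ⟨l, rfl⟩ : ∃ l, m = l + 1 := ⟨m - 1, by omega⟩
    obtain ⟨u, rfl⟩ := hsurj.iterate l a
    obtain ⟨v, rfl⟩ := hsurj.iterate l b
    rw [← Function.iterate_succ_apply' f l, hp] at ha hb
    rw [ha, hb]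
  have hinv : ∀ p, (∀ z, f^[m] z = p ↔ z = p) → ∀ y, f y = p → ∀ z, f^[m] z = y → z = y := by
    intro p hp y hy z hz
    refine huniq p hp _ _ ?_ hy
    rw [← hp, ← Function.iterate_succ_apply, Function.iterate_succ_apply', hz, hy]
  -- As `f^[m]` is `c z ^ N` with `N = n ^ m ≥ 2`, multiplying by a primitive `N`-th root of unity
  -- gives a second preimage of any point other than `0` and `∞`.
  have htwo : ∀ y, (∀ z, f^[m] z = y → z = y) → y = ((0 : ℂ) : Sphere) ∨ y = ∞ := by
    intro y hy
    by_contra! hcon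
    obtain ⟨x, w, hxw, rfl⟩ := exists_eq_pt y
    rw [Ne, pt_eq_zero_iff hxw, Ne, pt_eq_infty_iff] at hcon
    obtain ⟨z, hz⟩ := (hsurj.iterate m) (pt x w)
    have hz' := hy z hz
    rw [hz'] at hz
    have hω := Complex.isPrimitiveRoot_exp (n ^ m) hNpos
    set ω := Complex.exp (2 * Real.pi * Complex.I / (n ^ m : ℕ))
    have hω0 : ω ≠ 0 := hω.ne_zero hNpos
    have h2 := hy (pt (ω * x) w) (by
      rw [hB _ _ (Or.inr hcon.2), mul_pow, hω.pow_eq_one, one_mul, ← hB _ _ hxw, hz])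
    rw [pt_eq_pt_iff (Or.inr hcon.2) hxw] at h2
    refine hω.ne_one hN2 ?_
    have : (ω - 1) * (x * w) = 0 := by linear_combination h2
    have := (mul_eq_zero.1 this).resolve_right (mul_ne_zero hcon.1 hcon.2)
    linear_combination this
  obtain ⟨y₀, hy₀⟩ := hsurj ((0 : ℂ) : Sphere)
  obtain ⟨y₁, hy₁⟩ := hsurj ∞
  have hy01 : y₀ ≠ y₁ := by
    rintro rfl
    exact zero_ne_infty (hy₀.symm.trans hy₁)
  have hu0 := fun z hz => huniq _ h0 z y₀ hz hy₀
  have hu1 := fun z hz => huniq _ h1 z y₁ hz hy₁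
  rcases htwo y₀ (hinv _ h0 y₀ hy₀) with rfl | rfl <;>
    rcases htwo y₁ (hinv _ h1 y₁ hy₁) with rfl | rfl
  · exact absurd rfl hy01
  · exact Or.inl ⟨hu0, hu1⟩
  · exact Or.inr ⟨hu0, hu1⟩
  · exact absurd rfl hy01

lemma form_X_pow (n : ℕ) (x y : ℂ) : form n (Polynomial.X ^ n) x y = x ^ n := by
  rw [form, Finset.sum_range_succ, Finset.sum_eq_zero]
  · simp
  · intro i hi
    have := Finset.mem_range.1 hi
    rw [Polynomial.coeff_X_pow, if_neg (by omega)]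
    simp

lemma form_one_poly (n : ℕ) (x y : ℂ) : form n 1 x y = y ^ n := by
  rw [form, Finset.sum_range_succ', Finset.sum_eq_zero]
  · simp
  · intro i hi
    rw [Polynomial.coeff_one, if_neg (by omega)]
    simp

lemma toMap_X_pow (n : ℕ) {x y : ℂ} (h : x ≠ 0 ∨ y ≠ 0) :
    toMap (RatFunc.X ^ n) (pt x y) = pt (x ^ n) (y ^ n) := by
  have hX : (RatFunc.X ^ n : RatFunc ℂ) = algebraMap _ _ (Polynomial.X ^ n : Polynomial ℂ) := by
    rw [map_pow, RatFunc.algebraMap_X]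
  have hnum : (RatFunc.X ^ n : RatFunc ℂ).num = Polynomial.X ^ n := by
    rw [hX, RatFunc.num_algebraMap]
  have hden : (RatFunc.X ^ n : RatFunc ℂ).denom = 1 := by
    rw [hX, RatFunc.denom_algebraMap]
  have hdeg : degree (RatFunc.X ^ n) = n := by simp [degree, hnum, hden]
  rw [toMap_pt h, hdeg, hnum, hden, form_X_pow, form_one_poly]

lemma toMap_X_pow_inv (n : ℕ) {x y : ℂ} (h : x ≠ 0 ∨ y ≠ 0) :
    toMap ((RatFunc.X ^ n)⁻¹) (pt x y) = pt (y ^ n) (x ^ n) := by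
  have hX : ((RatFunc.X ^ n)⁻¹ : RatFunc ℂ) =
      algebraMap _ _ (1 : Polynomial ℂ) / algebraMap _ _ (Polynomial.X ^ n : Polynomial ℂ) := by
    rw [map_pow, RatFunc.algebraMap_X, map_one, one_div]
  have hne : (Polynomial.X ^ n : Polynomial ℂ) ≠ 0 := pow_ne_zero _ Polynomial.X_ne_zero
  have hnum : ((RatFunc.X ^ n)⁻¹ : RatFunc ℂ).num = 1 := by
    rw [hX, RatFunc.num_div]
    simp
  have hden : ((RatFunc.X ^ n)⁻¹ : RatFunc ℂ).denom = Polynomial.X ^ n := by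
    rw [hX, RatFunc.denom_div _ hne]
    simp
  have hdeg : degree ((RatFunc.X ^ n)⁻¹) = n := by simp [degree, hnum, hden]
  rw [toMap_pt h, hdeg, hnum, hden, form_X_pow, form_one_poly]

lemma exists_scaling {t : ℂ} (ht : t ≠ 0) :
    ∃ γ : Moebius, ∀ x y : ℂ, (x ≠ 0 ∨ y ≠ 0) → γ • pt x y = pt (t * x) y := by
  obtain ⟨γ, hγ⟩ := exists_moebius (a := t) (b := 0) (c := 0) (d := 1) (by simpa using ht)
  exact ⟨γ, fun x y h => by rw [hγ x y h]; simp⟩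

lemma coord_pow_ne_zero {x y c : ℂ} (hc : c ≠ 0) (n : ℕ) (h : x ≠ 0 ∨ y ≠ 0) :
    c * x ^ n ≠ 0 ∨ y ^ n ≠ 0 :=
  h.imp (fun h => mul_ne_zero hc (pow_ne_zero _ h)) (pow_ne_zero _)

lemma isConjugateToPower_of_pow {A : RatFunc ℂ} (hdeg : 2 ≤ degree A) {β : Moebius} {c : ℂ}
    (hc : c ≠ 0) (h : ∀ x y : ℂ, (x ≠ 0 ∨ y ≠ 0) →
      β • toMap A (β⁻¹ • pt x y) = pt (c * x ^ degree A) (y ^ degree A)) :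
    IsConjugateToPower A := by
  -- The scaling by `t` turns `c z ^ n` into `z ^ n` exactly when `t * c = t ^ n`.
  obtain ⟨t, ht⟩ := IsAlgClosed.exists_pow_nat_eq c (n := degree A - 1) (by omega)
  have ht0 : t ≠ 0 := by
    rintro rfl
    rw [zero_pow (by omega)] at ht
    exact hc ht.symm
  obtain ⟨γ, hγ⟩ := exists_scaling ht0
  refine ⟨γ * β, Or.inl fun z => ?_⟩
  obtain ⟨x, y, hxy, hz⟩ := exists_eq_pt (β • z)
  have hz' : z = β⁻¹ • pt x y := by rw [← hz, inv_smul_smul]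
  rw [mul_smul, mul_smul, hz, hγ _ _ hxy, toMap_X_pow _ (by simpa [ht0] using hxy), hz', h _ _ hxy,
    hγ _ _ (coord_pow_ne_zero hc _ hxy)]
  congr 1
  obtain ⟨n, hn⟩ : ∃ n, degree A = n + 1 := ⟨degree A - 1, by omega⟩
  rw [hn] at ht ⊢
  simp only [Nat.add_sub_cancel] at ht
  rw [← ht]
  ring

lemma isConjugateToPower_of_inv_pow {A : RatFunc ℂ} {β : Moebius} {c : ℂ}
    (hc : c ≠ 0) (h : ∀ x y : ℂ, (x ≠ 0 ∨ y ≠ 0) →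
      β • toMap A (β⁻¹ • pt x y) = pt (c * y ^ degree A) (x ^ degree A)) :
    IsConjugateToPower A := by
  -- For `c z ^ (-n)` the condition is `t * c = t ^ (-n)`.
  obtain ⟨t, ht⟩ := IsAlgClosed.exists_pow_nat_eq c⁻¹ (n := degree A + 1) (by omega)
  have ht0 : t ≠ 0 := by
    rintro rfl
    rw [zero_pow (by omega)] at ht
    exact inv_ne_zero hc ht.symm
  obtain ⟨γ, hγ⟩ := exists_scaling ht0
  refine ⟨γ * β, Or.inr fun z => ?_⟩
  obtain ⟨x, y, hxy, hz⟩ := exists_eq_pt (β • z)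
  have hz' : z = β⁻¹ • pt x y := by rw [← hz, inv_smul_smul]
  rw [mul_smul, mul_smul, hz, hγ _ _ hxy, toMap_X_pow_inv _ (by simpa [ht0] using hxy), hz',
    h _ _ hxy, hγ _ _ (coord_pow_ne_zero hc _ hxy.symm), ← pt_mul_mul (pow_ne_zero (degree A) ht0)]
  congr 1
  · have : t ^ degree A * t * c = 1 := by rw [← pow_succ, ht, inv_mul_cancel₀ hc]
    linear_combination y ^ degree A * this
  · ring

lemma conj_iterate (f : Sphere → Sphere) (β : Moebius) (k : ℕ) (z : Sphere) :
    (fun z => β • f (β⁻¹ • z))^[k] z = β • f^[k] (β⁻¹ • z) := by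
  induction k generalizing z with
  | zero => simp
  | succ k ih => rw [Function.iterate_succ_apply, ih, inv_smul_smul, Function.iterate_succ_apply]

lemma isConjugateToPower_of_totally_invariant {A : RatFunc ℂ} (hdeg : 2 ≤ degree A) {m : ℕ}
    (hm : 1 ≤ m) {z₀ z₁ : Sphere} (hne : z₀ ≠ z₁) (h0 : ∀ z, (toMap A)^[m] z = z₀ ↔ z = z₀)
    (h1 : ∀ z, (toMap A)^[m] z = z₁ ↔ z = z₁) : IsConjugateToPower A := by
  obtain ⟨β, hβ0, hβ1⟩ := exists_moebius_zero_infty hne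
  have hf := (isRational_toMap A).conj β
  rcases hf.totally_invariant_of_iterate hdeg hm
    (fun z => by rw [conj_iterate, ← hβ0, smul_left_cancel_iff, h0, inv_smul_eq_iff])
    (fun z => by rw [conj_iterate, ← hβ1, smul_left_cancel_iff, h1, inv_smul_eq_iff])
    with ⟨e0, e1⟩ | ⟨e0, e1⟩
  · obtain ⟨c, hc, h⟩ := hf.eq_pow e0 e1
    exact isConjugateToPower_of_pow hdeg hc h
  · obtain ⟨c, hc, h⟩ := hf.eq_inv_pow e0 e1
    exact isConjugateToPower_of_inv_pow hc h

/-! ### Germs of rational maps and the group `G(f, z₀, z₁)` -/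

lemma IsRational.eq_of_eventually {f g : Sphere → Sphere} {N M : ℕ} (hf : IsRational f N)
    (hg : IsRational g M) (h : ∀ᶠ z : ℂ in 𝓝 0, f z = g z) : f = g := by
  refine hf.eq_of_infinite hg ?_
  have hinf : {z : ℂ | f z = g z}.Infinite := infinite_of_mem_nhds 0 h
  refine (hinf.image (OnePoint.coe_injective.injOn)).mono ?_
  rintro _ ⟨z, hz, rfl⟩
  exact hz

/-- The germ at `0` of a rational map fixing `0`. -/
lemma IsRational.exists_germ {f : Sphere → Sphere} {N : ℕ} (hf : IsRational f N)
    (h0 : f ((0 : ℂ) : Sphere) = ((0 : ℂ) : Sphere)) :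
    ∃ b : ℂ → ℂ, AnalyticAt ℂ b 0 ∧ b 0 = 0 ∧ ∀ᶠ z : ℂ in 𝓝 0, f z = (b z : Sphere) := by
  obtain ⟨P, Q, hf⟩ := hf
  have hval : ∀ z : ℂ, f z = pt (P.eval z) (Q.eval z) := by
    intro z
    rw [← pt_one, hf.map_pt _ _ (by simp), form_one hf.natDegree_left, form_one hf.natDegree_right]
  have hne := hf.ne_zero 0 1 (by simp)
  rw [form_one hf.natDegree_left, form_one hf.natDegree_right] at hne
  have hP0 : P.eval 0 = 0 := by rwa [hval, pt_eq_zero_iff hne] at h0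
  have hQ0 : Q.eval 0 ≠ 0 := by simpa [hP0] using hne
  refine ⟨fun z => P.eval z / Q.eval z, ?_, by simp [hP0], ?_⟩
  · have hA : ∀ R : Polynomial ℂ, AnalyticAt ℂ (fun z => R.eval z) 0 := fun R => by
      simpa using analyticAt_id.aeval_polynomial (z := (0 : ℂ)) R
    exact (hA P).div (hA Q) hQ0
  · filter_upwards [Q.continuous.continuousAt.eventually_ne hQ0] with z hz
    rw [hval, pt, if_neg hz]

lemma eventually_iterate_eq {f : Sphere → Sphere} {b : ℂ → ℂ} (hb : Tendsto b (𝓝 0) (𝓝 0))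
    (h : ∀ᶠ z : ℂ in 𝓝 0, f z = (b z : Sphere)) (r : ℕ) :
    ∀ᶠ z : ℂ in 𝓝 0, f^[r] z = (b^[r] z : Sphere) := by
  induction r with
  | zero => simp
  | succ r ih =>
    filter_upwards [h, hb.eventually ih] with z h1 h2
    rw [Function.iterate_succ_apply, Function.iterate_succ_apply, h1, h2]

lemma IsRational.not_eventually_eq_self {f : Sphere → Sphere} {N : ℕ} (hf : IsRational f N)
    (hN : 2 ≤ N) : ¬ ∀ᶠ z : ℂ in 𝓝 0, f z = z := by
  intro h
  have hid : f = fun z => (1 : Moebius) • z :=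
    hf.eq_of_eventually (isRational_moebius 1) (by simpa using h)
  have := hf.finite_fixedPoints hN
  rw [hid] at this
  simp only [one_smul] at this
  exact Set.infinite_univ (by simpa using this)

/-- The germ at `0` of a rational map of degree at least `2` fixing `0` has a finite order. -/
lemma IsRational.exists_germ_hasOrder {f : Sphere → Sphere} {N : ℕ} (hf : IsRational f N)
    (hN : 2 ≤ N) (h0 : f ((0 : ℂ) : Sphere) = ((0 : ℂ) : Sphere)) :
    ∃ (b : ℂ → ℂ) (s : ℕ) (c : ℂ), 1 ≤ s ∧ c ≠ 0 ∧ HasOrder b s c ∧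
      (∀ᶠ z : ℂ in 𝓝 0, f z = (b z : Sphere)) ∧ ∀ t, 1 ≤ t → ¬ ∀ᶠ z in 𝓝 0, b^[t] z = z := by
  obtain ⟨b, hbA, hb0, hfb⟩ := hf.exists_germ h0
  have hnz : ¬ ∀ᶠ z in 𝓝 0, b z = 0 := by
    intro h
    refine infinite_of_mem_nhds (0 : ℂ) (h.and hfb)
      (Set.Finite.of_finite_image ((hf.finite_fibre (by omega) ((0 : ℂ) : Sphere)).subset ?_)
        (OnePoint.coe_injective.injOn))
    rintro _ ⟨z, ⟨h1, h2⟩, rfl⟩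
    have h1 : b z = 0 := h1
    have h2 : f z = (b z : Sphere) := h2
    rw [Set.mem_preimage, h2, h1]
    rfl
  obtain ⟨s, c, hc, hb⟩ := HasOrder.exists_of_analyticAt hbA hnz
  have hs : 1 ≤ s := by
    rw [Nat.one_le_iff_ne_zero]
    rintro rfl
    obtain ⟨G, -, hG0, hG⟩ := hb
    have := hG.self_of_nhds
    rw [hb0, pow_zero, one_mul, hG0] at this
    exact hc this.symm
  refine ⟨b, s, c, hs, hc, hb, hfb, fun t ht h => ?_⟩
  refine (hf.iterate t).not_eventually_eq_self (hN.trans (Nat.le_self_pow (by omega) N)) ?_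
  filter_upwards [h, eventually_iterate_eq (hb.tendsto_zero hs) hfb t] with z h1 h2
  rw [h2, h1]

lemma pow_smul_pt {τ : Moebius} {ε : ℂ} (hε : ε ≠ 0)
    (hτ : ∀ x y : ℂ, (x ≠ 0 ∨ y ≠ 0) → τ • pt x y = pt (ε * x) y) (m : ℕ) {x y : ℂ}
    (h : x ≠ 0 ∨ y ≠ 0) : τ ^ m • pt x y = pt (ε ^ m * x) y := by
  induction m with
  | zero => simp
  | succ m ih =>
    rw [pow_succ', mul_smul, ih, hτ _ _ (h.imp_left (mul_ne_zero (pow_ne_zero m hε)))]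
    congr 1
    ring

lemma pow_smul_coe {τ : Moebius} {ε : ℂ} (hε : ε ≠ 0)
    (hτ : ∀ x y : ℂ, (x ≠ 0 ∨ y ≠ 0) → τ • pt x y = pt (ε * x) y) (m : ℕ) (z : ℂ) :
    τ ^ m • (z : Sphere) = ((ε ^ m * z : ℂ) : Sphere) := by
  rw [← pt_one, pow_smul_pt hε hτ m (by simp), pt_one]

lemma smul_coe {τ : Moebius} {ε : ℂ}
    (hτ : ∀ x y : ℂ, (x ≠ 0 ∨ y ≠ 0) → τ • pt x y = pt (ε * x) y) (z : ℂ) :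
    τ • (z : Sphere) = ((ε * z : ℂ) : Sphere) := by
  rw [← pt_one, hτ _ _ (by simp), pt_one]

lemma germ_equivariant {f : Sphere → Sphere} {b : ℂ → ℂ}
    (hfb : ∀ᶠ z : ℂ in 𝓝 0, f z = (b z : Sphere)) {τ : Moebius} {ε : ℂ} (hε : ε ≠ 0)
    (hτ : ∀ x y : ℂ, (x ≠ 0 ∨ y ≠ 0) → τ • pt x y = pt (ε * x) y) {m : ℕ}
    (h : ∀ z, f (τ • z) = τ ^ m • f z) : ∀ᶠ z in 𝓝 0, b (ε * z) = ε ^ m * b z := by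
  filter_upwards [hfb, (tendsto_mul_nhds_zero ε).eventually hfb] with z h1 h2
  have := h z
  rwa [smul_coe hτ, h1, h2, pow_smul_coe hε hτ, OnePoint.coe_eq_coe] at this

/-- The local descent for germs becomes a global identity because rational maps agreeing near `0`
are equal. The exponent `s` is the local order of `f` at `0`. -/
lemma IsRational.equivariant_of_iterate_zero_infty {f : Sphere → Sphere} {N : ℕ}
    (hf : IsRational f N) (hN : 2 ≤ N) (h0 : f ((0 : ℂ) : Sphere) = ((0 : ℂ) : Sphere))
    {τ : Moebius} (hτ0 : τ • ((0 : ℂ) : Sphere) = ((0 : ℂ) : Sphere)) (hτ1 : τ • (∞ : Sphere) = ∞)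
    {r m : ℕ} (hr : 1 ≤ r) (h : ∀ z, f^[r] (τ • z) = τ ^ m • f^[r] z) :
    ∃ s, 1 ≤ s ∧ ∀ z, f (τ • z) = τ ^ s • f z := by
  obtain ⟨ε, hε, hτ⟩ := moebius_diagonal hτ0 hτ1
  obtain ⟨b, s, c, hs, hc, hb, hfb, hid⟩ := hf.exists_germ_hasOrder hN h0
  have hbs := scaling_of_iterate_scaling hs hc hb hid hε hr
    (germ_equivariant (eventually_iterate_eq (hb.tendsto_zero hs) hfb r) hε hτ h)
  refine ⟨s, hs, fun z => ?_⟩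
  refine congrFun ((hf.comp (isRational_moebius τ)).eq_of_eventually
    ((isRational_moebius (τ ^ s)).comp hf) ?_) z
  filter_upwards [hfb, (tendsto_mul_nhds_zero ε).eventually hfb, hbs] with z h1 h2 h3
  simp only [Function.comp_apply]
  rw [smul_coe hτ, h1, h2, pow_smul_coe hε hτ, h3]

/-- If an iterate of `f` is equivariant with respect to `τ`, then so is `f`. -/
lemma IsRational.equivariant_of_iterate {f : Sphere → Sphere} {N : ℕ} (hf : IsRational f N)
    (hN : 2 ≤ N) {z₀ z₁ : Sphere} (hne : z₀ ≠ z₁) (h0 : f z₀ = z₀) {τ : Moebius}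
    (hτ0 : τ • z₀ = z₀) (hτ1 : τ • z₁ = z₁) {r m : ℕ} (hr : 1 ≤ r)
    (h : ∀ z, f^[r] (τ • z) = τ ^ m • f^[r] z) : ∃ s, 1 ≤ s ∧ ∀ z, f (τ • z) = τ ^ s • f z := by
  obtain ⟨β, hβ0, hβ1⟩ := exists_moebius_zero_infty hne
  have hb0 : β⁻¹ • ((0 : ℂ) : Sphere) = z₀ := by rw [← hβ0, inv_smul_smul]
  have hb1 : β⁻¹ • (∞ : Sphere) = z₁ := by rw [← hβ1, inv_smul_smul]
  obtain ⟨s, hs, H⟩ := (hf.conj β).equivariant_of_iterate_zero_infty hN (by simp only [hb0, h0, hβ0])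
    (τ := β * τ * β⁻¹) (by rw [mul_smul, mul_smul, hb0, hτ0, hβ0])
    (by rw [mul_smul, mul_smul, hb1, hτ1, hβ1]) hr (m := m) (fun z => by
      rw [conj_iterate, conj_iterate, conj_pow, mul_smul, mul_smul, mul_smul, mul_smul,
        inv_smul_smul, inv_smul_smul, h])
  refine ⟨s, hs, fun z => ?_⟩
  have := H (β • z)
  simpa only [conj_pow, mul_smul, inv_smul_smul, smul_left_cancel_iff] using this

lemma isRational_monomial {c : ℂ} (hc : c ≠ 0) (s : ℕ) :
    ∃ (g : Sphere → Sphere) (M : ℕ), IsRational g M ∧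
      ∀ x y : ℂ, (x ≠ 0 ∨ y ≠ 0) → g (pt x y) = pt (c * x ^ s) (y ^ s) := by
  obtain ⟨γ, hγ⟩ := exists_scaling hc
  refine ⟨_, _, (isRational_moebius γ).comp (isRational_toMap (RatFunc.X ^ s)), fun x y h => ?_⟩
  have := coord_pow_ne_zero one_ne_zero s h
  rw [one_mul] at this
  rw [Function.comp_apply, toMap_X_pow s h, hγ _ _ this]

/-- If the germ were exactly `c z ^ s`, then `f` would be that monomial, and `0` and `∞` totally
invariant. So there is a next term, of order `i > s`, and equivariance under `z ↦ ε z` forces `ε ^ s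
= ε ^ m = ε ^ i`. -/
lemma IsRational.finite_localG_zero_infty {f : Sphere → Sphere} {N : ℕ} (hf : IsRational f N)
    (hN : 2 ≤ N) (h0 : f ((0 : ℂ) : Sphere) = ((0 : ℂ) : Sphere))
    (h : ¬ ((∀ z, f z = ((0 : ℂ) : Sphere) ↔ z = ((0 : ℂ) : Sphere)) ∧ ∀ z, f z = ∞ ↔ z = ∞)) :
    (localG f ((0 : ℂ) : Sphere) ∞).Finite := by
  obtain ⟨b, s, c, hs, hc, hb, hfb, -⟩ := hf.exists_germ_hasOrder hN h0
  have hA : AnalyticAt ℂ (fun z => b z + -c * z ^ s) 0 :=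
    hb.analyticAt.add (analyticAt_const.mul (analyticAt_id.pow s))
  have hnz : ¬ ∀ᶠ z in 𝓝 0, b z + -c * z ^ s = 0 := by
    intro hev
    obtain ⟨g, M, hg, hgv⟩ := isRational_monomial hc s
    have hfg : f = g := hf.eq_of_eventually hg (by
      filter_upwards [hev, hfb] with z h1 h2
      rw [h2, ← pt_one z, hgv _ _ (by simp), one_pow, pt_one, OnePoint.coe_eq_coe]
      linear_combination h1)
    refine h ⟨fun z => ?_, fun z => ?_⟩ <;>
      obtain ⟨x, y, hxy, rfl⟩ := exists_eq_pt z
    · rw [hfg, hgv _ _ hxy, pt_eq_zero_iff (coord_pow_ne_zero hc s hxy), pt_eq_zero_iff hxy]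
      simp [hc, Nat.one_le_iff_ne_zero.1 hs]
    · rw [hfg, hgv _ _ hxy, pt_eq_infty_iff, pt_eq_infty_iff]
      simp [Nat.one_le_iff_ne_zero.1 hs]
  obtain ⟨i, d, hd, hi⟩ := HasOrder.exists_of_analyticAt hA hnz
  have hpow : Lead (fun z => z ^ s) s 1 := by
    have : HasOrder (fun z => z ^ s) s 1 := ⟨fun _ => 1, analyticAt_const, rfl, by simp⟩
    exact this.lead
  have hsi : s < i := by
    refine Lead.order_lt ?_ hi.lead hd
    simpa using hb.lead.add (hpow.const_mul (-c))
  have hfin : {ε : ℂ | ε ^ (i - s) = 1}.Finite := by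
    have hne : (Polynomial.X ^ (i - s) - 1 : Polynomial ℂ) ≠ 0 :=
      Polynomial.X_pow_sub_C_ne_zero (by omega) 1
    refine (Polynomial.X ^ (i - s) - 1 : Polynomial ℂ).roots.toFinset.finite_toSet.subset ?_
    intro ε hε
    have hε : ε ^ (i - s) = 1 := hε
    simp [hne, hε]
  have h01 : ((0 : ℂ) : Sphere) ≠ ((1 : ℂ) : Sphere) := by simp
  refine finite_of_maps_three (zero_ne_infty) h01 (OnePoint.infty_ne_coe 1)
    (K := {((0 : ℂ) : Sphere), ∞} ∪ (fun z : ℂ => (z : Sphere)) '' {ε : ℂ | ε ^ (i - s) = 1})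
    ((Set.toFinite _).union (hfin.image _)) ?_
  rintro τ ⟨-, hτ0, hτ1, m, -, hm⟩
  obtain ⟨ε, hε, hτ⟩ := moebius_diagonal hτ0 hτ1
  refine ⟨by simp [hτ0], by simp [hτ1], Or.inr ⟨ε, ?_, by rw [smul_coe hτ]; simp⟩⟩
  have hbe := germ_equivariant hfb hε hτ hm
  have hms : ε ^ m = ε ^ s := by
    have h1 := (hb.lead.scale hε).unique ((hb.lead.const_mul (ε ^ m)).congr
      (by filter_upwards [hbe] with z hz; rw [hz]))
    exact (mul_right_cancel₀ hc h1).symm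
  have his : ε ^ i = ε ^ s := by
    have h1 := (hi.lead.scale hε).unique ((hi.lead.const_mul (ε ^ s)).congr
      (by filter_upwards [hbe] with z hz; rw [hz, hms]; ring))
    exact mul_right_cancel₀ hd h1
  have e : ε ^ i = ε ^ s * ε ^ (i - s) := by rw [← pow_add]; congr 1; omega
  rw [e] at his
  have : ε ^ s * (ε ^ (i - s) - 1) = 0 := by linear_combination his
  exact sub_eq_zero.1 ((mul_eq_zero.1 this).resolve_left (pow_ne_zero _ hε))

lemma IsRational.finite_localG {f : Sphere → Sphere} {N : ℕ} (hf : IsRational f N)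
    (hN : 2 ≤ N) {z₀ z₁ : Sphere} (hne : z₀ ≠ z₁) (h0 : f z₀ = z₀)
    (h : ¬ ((∀ z, f z = z₀ ↔ z = z₀) ∧ ∀ z, f z = z₁ ↔ z = z₁)) : (localG f z₀ z₁).Finite := by
  obtain ⟨β, hβ0, hβ1⟩ := exists_moebius_zero_infty hne
  have hb0 : β⁻¹ • ((0 : ℂ) : Sphere) = z₀ := by rw [← hβ0, inv_smul_smul]
  have hb1 : β⁻¹ • (∞ : Sphere) = z₁ := by rw [← hβ1, inv_smul_smul]
  have hfin := (hf.conj β).finite_localG_zero_infty hN (by simp only [hb0, h0, hβ0]) (by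
    rintro ⟨e0, e1⟩
    refine h ⟨fun z => ?_, fun z => ?_⟩
    · have := e0 (β • z)
      rwa [inv_smul_smul, ← hβ0, smul_left_cancel_iff, smul_left_cancel_iff] at this
    · have := e1 (β • z)
      rwa [inv_smul_smul, ← hβ1, smul_left_cancel_iff, smul_left_cancel_iff] at this)
  refine Set.Finite.of_finite_image (f := fun τ => β * τ * β⁻¹) (hfin.subset ?_)
    (fun τ _ τ' _ he => by simpa using he)
  rintro _ ⟨τ, ⟨-, hτ0, hτ1, m, hm, H⟩, rfl⟩
  have key : ∀ z, β • f (β⁻¹ • ((β * τ * β⁻¹) • z)) = (β * τ * β⁻¹) ^ m • β • f (β⁻¹ • z) := by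
    intro z
    rw [conj_pow, mul_smul, mul_smul, mul_smul, mul_smul, inv_smul_smul, inv_smul_smul, H]
  exact ⟨⟨_, key⟩, by rw [mul_smul, mul_smul, hb0, hτ0, hβ0],
    by rw [mul_smul, mul_smul, hb1, hτ1, hβ1], m, hm, key⟩

/-! ### Counting, and passage between iterates -/

/-- The index-two counting: if the elements of `T` fixing `z₀` lie in `L` and the other ones
send `z₀` to `z₁`, then `T` has at most `2 |L|` elements. -/
lemma finite_and_ncard_le_two_mul {T L : Set Moebius} {z₀ z₁ : Sphere}
    (hT : ∀ τ ∈ T, ∀ τ' ∈ T, τ⁻¹ * τ' ∈ T) (hz : ∀ τ ∈ T, τ • z₀ = z₀ ∨ τ • z₀ = z₁)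
    (hTL : ∀ τ ∈ T, τ • z₀ = z₀ → τ ∈ L) (hL : L.Finite) :
    T.Finite ∧ T.ncard ≤ 2 * L.ncard := by
  obtain ⟨τ₀, hτ₀⟩ : ∃ τ₀ : Moebius, ∀ τ ∈ T, τ • z₀ = z₁ → τ₀⁻¹ * τ ∈ L := by
    by_cases h : ∃ τ ∈ T, τ • z₀ = z₁
    · obtain ⟨τ₀, h1, h2⟩ := h
      refine ⟨τ₀, fun τ hτ hτ1 => hTL _ (hT _ h1 _ hτ) ?_⟩
      rw [mul_smul, hτ1, inv_smul_eq_iff, h2]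
    · exact ⟨1, fun τ hτ hτ1 => absurd ⟨τ, hτ, hτ1⟩ h⟩
  have hsub : T ⊆ L ∪ (fun τ => τ₀ * τ) '' L := fun τ hτ => by
    rcases hz τ hτ with h | h
    · exact Or.inl (hTL τ hτ h)
    · exact Or.inr ⟨_, hτ₀ τ hτ h, by simp⟩
  have hfin : (L ∪ (fun τ => τ₀ * τ) '' L).Finite := hL.union (hL.image _)
  refine ⟨hfin.subset hsub, (Set.ncard_le_ncard hsub hfin).trans ((Set.ncard_union_le _ _).trans ?_)⟩
  have := Set.ncard_image_le (f := fun τ => τ₀ * τ) hL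
  omega

lemma mem_symAut_iterate {f : Sphere → Sphere} {τ : Moebius} (h : τ ∈ symAut f) (j : ℕ) :
    τ ∈ symAut f^[j] := by
  intro z
  have h : ∀ z, f (τ • z) = τ • f z := h
  exact ((Function.Semiconj.iterate_left (g := fun _ : ℕ => fun w : Sphere => τ • w)
    (fun n z => h z) j) 0 z)

lemma mem_symSigma_iterate {f : Sphere → Sphere} {τ : Moebius} (h : τ ∈ symSigma f) {j : ℕ}
    (hj : 1 ≤ j) : τ ∈ symSigma f^[j] := by
  intro z
  have h : ∀ z, f (τ • z) = f z := h
  obtain ⟨j, rfl⟩ : ∃ i, j = i + 1 := ⟨j - 1, by omega⟩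
  rw [Function.iterate_succ_apply, Function.iterate_succ_apply, h]

lemma mem_autInf {f : Sphere → Sphere} {τ : Moebius} :
    τ ∈ autInf f ↔ ∃ j, 1 ≤ j ∧ τ ∈ symAut f^[j] := by
  simp [autInf]

lemma mem_sigmaInf {f : Sphere → Sphere} {τ : Moebius} :
    τ ∈ sigmaInf f ↔ ∃ j, 1 ≤ j ∧ τ ∈ symSigma f^[j] := by
  simp [sigmaInf]

lemma mem_symAut_mul {f : Sphere → Sphere} {τ : Moebius} {i : ℕ} (h : τ ∈ symAut f^[i]) (j : ℕ) :
    τ ∈ symAut f^[i * j] := by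
  rw [Function.iterate_mul]
  exact mem_symAut_iterate h j

lemma mem_symSigma_mul {f : Sphere → Sphere} {τ : Moebius} {i : ℕ} (h : τ ∈ symSigma f^[i]) {j : ℕ}
    (hj : 1 ≤ j) : τ ∈ symSigma f^[i * j] := by
  rw [Function.iterate_mul]
  exact mem_symSigma_iterate h hj

end RationalDynamics

end

open RationalDynamics in
theorem theorem6p2 (A : RatFunc ℂ) (hdeg : 2 ≤ RationalDynamics.degree A)
    (hconj : ¬ RationalDynamics.IsConjugateToPower A)
    (k : ℕ) (hk : 1 ≤ k)
    (σ : RationalDynamics.Moebius) (hσ : 5 < orderOf σ)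
    (z₀ z₁ : RationalDynamics.Sphere) (hne : z₀ ≠ z₁)
    (hσ₀ : σ • z₀ = z₀) (hσ₁ : σ • z₁ = z₁)
    (hfix : (RationalDynamics.toMap A)^[k] z₀ = z₀) :
    (σ ∈ RationalDynamics.symAut (RationalDynamics.toMap A)^[k] →
      (RationalDynamics.autInf (RationalDynamics.toMap A)).Finite ∧
      (RationalDynamics.localG (RationalDynamics.toMap A)^[k] z₀ z₁).Finite ∧
      (RationalDynamics.autInf (RationalDynamics.toMap A)).ncard ≤
        2 * (RationalDynamics.localG (RationalDynamics.toMap A)^[k] z₀ z₁).ncard) ∧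
    (σ ∈ RationalDynamics.symSigma (RationalDynamics.toMap A)^[k] →
      (RationalDynamics.sigmaInf (RationalDynamics.toMap A)).Finite ∧
      (RationalDynamics.localG (RationalDynamics.toMap A)^[k] z₀ z₁).Finite ∧
      (RationalDynamics.sigmaInf (RationalDynamics.toMap A)).ncard ≤
        2 * (RationalDynamics.localG (RationalDynamics.toMap A)^[k] z₀ z₁).ncard) := by
  have hf := isRational_toMap A
  have hdegpow : ∀ m, 1 ≤ m → 2 ≤ degree A ^ m := fun m hm =>
    hdeg.trans (Nat.le_self_pow (Nat.one_le_iff_ne_zero.1 hm) _)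
  have hti : ∀ m, 1 ≤ m → ∀ w, w ≠ z₀ → ¬ ((∀ z, (toMap A)^[m] z = z₀ ↔ z = z₀) ∧
      ∀ z, (toMap A)^[m] z = w ↔ z = w) := fun m hm w hw ⟨h0, h1⟩ =>
    hconj (isConjugateToPower_of_totally_invariant hdeg hm hw.symm h0 h1)
  have hL : (localG (toMap A)^[k] z₀ z₁).Finite :=
    (hf.iterate k).finite_localG (hdegpow k hk) hne hfix (hti k hk z₁ hne.symm)
  have hfixm : ∀ j, (toMap A)^[k * j] z₀ = z₀ := fun j => by
    rw [Function.iterate_mul]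
    exact Function.iterate_fixed hfix j
  -- a transformation fixing `z₀` and permuting `{z₀, z₁}` fixes `z₁`
  have hz₁ : ∀ τ : Moebius, τ • z₀ = z₀ → (τ • z₁ = z₁ ∨ τ • z₁ = z₀) → τ • z₁ = z₁ := by
    intro τ h0 h1
    refine h1.resolve_right fun h => hne ?_
    rw [← h0] at h
    exact ((smul_left_cancel_iff τ).1 h).symm
  -- Equivariance of the iterate `k * j` descends to the iterate `k`, which puts `τ` in `G(A^{∘k},
  -- z₀, z₁)`.
  have hlocal : ∀ (τ : Moebius) (j m : ℕ), 1 ≤ j → τ • z₀ = z₀ → τ • z₁ = z₁ →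
      (∀ z, (toMap A)^[k * j] (τ • z) = τ ^ m • (toMap A)^[k * j] z) →
      τ ∈ localG (toMap A)^[k] z₀ z₁ := by
    intro τ j m hj h0 h1 h
    rw [Function.iterate_mul] at h
    obtain ⟨s, hs, hs'⟩ := (hf.iterate k).equivariant_of_iterate (hdegpow k hk) hne hfix h0 h1 hj h
    exact ⟨⟨_, hs'⟩, h0, h1, s, hs, hs'⟩
  refine ⟨fun hσA => ?_, fun hσS => ?_⟩
  · have hfin : ∀ j, 1 ≤ j → Finite (symAut (toMap A)^[k * j]) := fun j hj =>
      (hf.iterate _).finite_symAut (hdegpow _ (Nat.mul_pos hk hj)) (hfixm j)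
        (hti _ (Nat.mul_pos hk hj))
    -- Exponents divisible by `k` put `τ` and `σ` into one finite group.
    have hmem : ∀ τ ∈ autInf (toMap A), ∃ j, 1 ≤ j ∧ τ ∈ symAut (toMap A)^[k * j] := by
      intro τ hτ
      obtain ⟨j, hj, hτ⟩ := mem_autInf.1 hτ
      exact ⟨j, hj, mul_comm j k ▸ mem_symAut_mul hτ k⟩
    have hbound := finite_and_ncard_le_two_mul (T := autInf (toMap A))
      (L := localG (toMap A)^[k] z₀ z₁) (z₀ := z₀) (z₁ := z₁)
      (fun τ hτ τ' hτ' => by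
        obtain ⟨i, hi, hτ⟩ := mem_autInf.1 hτ
        obtain ⟨j, hj, hτ'⟩ := mem_autInf.1 hτ'
        exact mem_autInf.2 ⟨i * j, Nat.mul_pos hi hj, mul_mem (inv_mem (mem_symAut_mul hτ j))
          (mul_comm j i ▸ mem_symAut_mul hτ' i)⟩)
      (fun τ hτ => by
        obtain ⟨j, hj, hτ⟩ := hmem τ hτ
        have := hfin j hj
        exact smul_eq_or_eq_of_mem (mem_symAut_mul hσA j) hσ hne hσ₀ hσ₁ hτ)
      (fun τ hτ h0 => by
        obtain ⟨j, hj, hτ⟩ := hmem τ hτ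
        have := hfin j hj
        refine hlocal τ j 1 hj h0 (hz₁ τ h0 (smul_eq_or_eq_of_mem (mem_symAut_mul hσA j) hσ
          hne.symm hσ₁ hσ₀ hτ)) fun z => ?_
        rw [pow_one]
        exact hτ z)
      hL
    exact ⟨hbound.1, hL, hbound.2⟩
  · have hfin : ∀ j, 1 ≤ j → Finite (symSigma (toMap A)^[k * j]) := fun j hj =>
      (hf.iterate _).finite_symSigma (one_le_two.trans (hdegpow _ (Nat.mul_pos hk hj)))
    have hmem : ∀ τ ∈ sigmaInf (toMap A), ∃ j, 1 ≤ j ∧ τ ∈ symSigma (toMap A)^[k * j] := by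
      intro τ hτ
      obtain ⟨j, hj, hτ⟩ := mem_sigmaInf.1 hτ
      exact ⟨j, hj, mul_comm j k ▸ mem_symSigma_mul hτ hk⟩
    have hbound := finite_and_ncard_le_two_mul (T := sigmaInf (toMap A))
      (L := localG (toMap A)^[k] z₀ z₁) (z₀ := z₀) (z₁ := z₁)
      (fun τ hτ τ' hτ' => by
        obtain ⟨i, hi, hτ⟩ := mem_sigmaInf.1 hτ
        obtain ⟨j, hj, hτ'⟩ := mem_sigmaInf.1 hτ'
        exact mem_sigmaInf.2 ⟨i * j, Nat.mul_pos hi hj,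
          mul_mem (inv_mem (mem_symSigma_mul hτ hj)) (mul_comm j i ▸ mem_symSigma_mul hτ' hi)⟩)
      (fun τ hτ => by
        obtain ⟨j, hj, hτ⟩ := hmem τ hτ
        have := hfin j hj
        exact smul_eq_or_eq_of_mem (mem_symSigma_mul hσS hj) hσ hne hσ₀ hσ₁ hτ)
      (fun τ hτ h0 => by
        obtain ⟨j, hj, hτ⟩ := hmem τ hτ
        have := hfin j hj
        -- Invariance under `τ` is equivariance with exponent `orderOf τ`, since that power of `τ`
        -- is `1`.
        refine hlocal τ j (orderOf τ) hj h0 (hz₁ τ h0 (smul_eq_or_eq_of_mem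
          (mem_symSigma_mul hσS hj) hσ hne.symm hσ₁ hσ₀ hτ)) fun z => ?_
        rw [pow_orderOf_eq_one, one_smul]
        exact hτ z)
      hL
    exact ⟨hbound.1, hL, hbound.2⟩
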